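/- Let $\alpha\in(0,1)$ be irrational with continued fraction expansion $\alpha=[a_1,a_2,\ldots]$, and let $q_n$ be the denominators of its convergents, i.e. $q_{-1}=0$, $q_0=1$ and $q_{n+1}=a_{n+1}q_n+q_{n-1}$ for $n\ge 0$. Let $\mathbb T=\mathbb R/\mathbb Z$ (identified with $[0,1)$) carry Lebesgue measure $\lambda$, let $R_\alpha(x)=x+\alpha \bmod 1$, let $\phi(x)=\frac1x+\frac1{1-x}$ for $x\in(0,1)$ (the value at the single point $0$ being irrelevant), and let $S_N(\phi)(x)=\sum_{k=0}^{N-1}\phi(R_\alpha^k x)$. For $n\ge 1$ with $q_n>1$ put $$W_n=W_n(\alpha)=\begin{cases}\dfrac{\log q_{n+1}-\log q_n}{\log q_n}&\text{if } q_{n+1}<2q_n\log q_n,\\[2ex] \dfrac{\max\left\{1,\ \log\log q_n-\log\log\frac{q_{n+1}}{q_n\log q_n}\right\}}{\log q_n}&\text{if } q_{n+1}\ge 2q_n\log q_n,\end{cases}$$ and put $W_n=0$ if $q_n=1$ (for $n\ge1$ this happens only if $n=1$ and $a_1=1$). All $W_n$ are non-negative. Then: 1. if $\sum_{n=1}^\infty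 W_n<\infty$, then $\displaystyle\limsup_{N\to\infty}\frac{\phi(R_\alpha^N x)}{S_N(\phi)(x)}=0$ for $\lambda$-almost every $x\in\mathbb T$; 2. if $\sum_{n=1}^\infty W_n=\infty$, then $\displaystyle\limsup_{N\to\infty}\frac{\phi(R_\alpha^N x)}{S_N(\phi)(x)}=\infty$ for $\lambda$-almost every $x\in\mathbb T$. -/

import Mathlib

noncomputable section

/-- The observable `φ(x) = 1/x + 1/(1-x)` on the one-torus `ℝ/ℤ`, where a point of the torus is
identified with its representative in `[0, 1)`. (At the single point `0`, a null set, the real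
value is the conventional `1`.) -/
def phi (x : UnitAddCircle) : ℝ :=
  1 / (AddCircle.equivIco (1 : ℝ) 0 x : ℝ) + 1 / (1 - (AddCircle.equivIco (1 : ℝ) 0 x : ℝ))

/-- The rotation `R_α(x) = x + α mod 1` on the one-torus. -/
def torusRotation (α : ℝ) (x : UnitAddCircle) : UnitAddCircle :=
  x + (α : UnitAddCircle)

/-- The denominator `q_n` of the `n`-th convergent of the continued fraction of `α`
(`q_0 = 1`, `q_1 = a_1`, `q_{n+1} = a_{n+1} q_n + q_{n-1}`), as a real number. -/
def cfDen (α : ℝ) (n : ℕ) : ℝ :=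
  (GenContFract.of α).dens n

open Classical in
/-- The quantity `W_n(α)`. If `q_n = 1` (which for `n ≥ 1` means `n = 1` and `a_1 = 1`), the
formula divides by `log 1 = 0`, and the value is `0`. -/
def W (α : ℝ) (n : ℕ) : ℝ :=
  if cfDen α (n + 1) < 2 * cfDen α n * Real.log (cfDen α n) then
    (Real.log (cfDen α (n + 1)) - Real.log (cfDen α n)) / Real.log (cfDen α n)
  else
    max 1 (Real.log (Real.log (cfDen α n)) -
        Real.log (Real.log (cfDen α (n + 1) / (cfDen α n * Real.log (cfDen α n))))) /
      Real.log (cfDen α n)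

/-- The extravagance `limsup_N φ(R_α^N x) / S_N(φ)(x)` as an extended real number, where
`S_N(φ)(x) = ∑_{k < N} φ(R_α^k x)` is the Birkhoff sum. -/
def extravagance (α : ℝ) (x : UnitAddCircle) : EReal :=
  Filter.limsup
    (fun N : ℕ => ((phi ((torusRotation α)^[N] x) / birkhoffSum (torusRotation α) phi N x : ℝ) : EReal))
    Filter.atTop

end

/-! Write `Q = q_n`, `Q' = q_{n+1}`, `L = log q_n` and let `Q ≤ N < Q'`. The value `φ(x + Nα)` is
comparable to `1 / ‖x + Nα‖`. The sum `S_N` has two sources. Every `Q` consecutive orbit points are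
nearly equidistributed, which gives order `N L`. If moreover `x + Nα` lies within about `1/Q'` of
the origin, the earlier times `N - jQ` give points at distance at most about `j/Q'`, and these close
returns add order `Q' log (N/Q)`.

Hence `φ(x + Nα)` can compete with `S_N` only if `x` lies in a ball about `-Nα` of radius of order
the smaller of `1/(N L)` and `1/(Q' log (N/Q))`, the second bound being used once `N/Q` is large.
With `Z = Q'/(Q L)`, the two radii cross near `N = Z (1 + log Z) Q`. If `Z < 2`, the first radius
alone gives total measure of order `log (Q'/Q) / L`. If `Z ≥ 2`, the times before the crossing cost
`O(1/L)` and those after it `(log L - log log Z) / L`. These are the two cases of `W_n`, so the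
exceptional set of the block has measure `O(W_n + 1/q_n)` (`volume_largeSet_le`). As `∑ 1/q_n < ∞`,
Borel–Cantelli settles the convergent case.

In the divergent case only times after the crossing (`startTime`) are kept. There the returns are
harmless, and on a ball of radius `c/(N L)` about `-Nα` one has `S_N ≤ 224 N L`
(`birkhoff_upper_bound`, `mul_log_le_of_startTime_le`). For fixed `n` these balls are disjoint, and
the measure of their union controls `W_n` up to a telescoping error (`W_le`). Unions for different
`n` are quasi-independent, because orbit segments visit balls with the expected frequency
(`sum_visits_le`). The Kochen–Stone inequality then gives a limsup set of positive measure, and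
ergodicity of the rotation carries the conclusion to almost every point. -/

/-- The properties of the sequence of denominators of the convergents of `α` that control the
distribution of the orbits of the rotation by `α`. -/
structure IsDenomSeq (α : ℝ) (q : ℕ → ℕ) : Prop where
  pos : ∀ n, 0 < q n
  mono' : ∀ n, q n ≤ q (n + 1)
  add_le : ∀ n, q n + q (n + 1) ≤ q (n + 2)
  exists_approx : ∀ n, ∃ p : ℤ, IsCoprime p (q n : ℤ) ∧ |q n * α - p| ≤ 1 / q (n + 1)
  sep : ∀ n j : ℕ, 0 < j → j < q (n + 1) →
    1 / (2 * q (n + 1) : ℝ) ≤ ‖(((j : ℝ) * α : ℝ) : UnitAddCircle)‖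

/-! ### Denominators of convergents and best approximation -/

namespace GenContFract

theorem of_not_terminatedAt_of_irrational {α : ℝ} (hα : Irrational α) (n : ℕ) :
    ¬ (GenContFract.of α).TerminatedAt n := by
  intro h
  obtain ⟨r, hr⟩ := (terminates_iff_rat α).1 ⟨n, h⟩
  exact hα ⟨r, hr.symm⟩

theorem exists_int_contsAux_of (v : ℝ) (n : ℕ) :
    (∃ a b : ℤ, (GenContFract.of v).contsAux n = ⟨a, b⟩) ∧ ∃ a b : ℤ, (GenContFract.of v).contsAux (n + 1) = ⟨a, b⟩ := by
  induction n with
  | zero =>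
    refine ⟨⟨1, 0, by simp⟩, ⌊v⌋, 1, by simp [of_h_eq_floor]⟩
  | succ n ih =>
    obtain ⟨⟨a, b, h₁⟩, c, d, h₂⟩ := ih
    refine ⟨⟨c, d, h₂⟩, ?_⟩
    rcases hs : (GenContFract.of v).s.get? n with _ | gp
    · exact ⟨c, d, by
        rw [← h₂]; exact contsAux_stable_step_of_terminated hs⟩
    · obtain ⟨h1, z, hz⟩ := of_partNum_eq_one_and_exists_int_partDen_eq hs
      refine ⟨z * c + a, z * d + b, ?_⟩
      rw [contsAux_recurrence hs h₁ h₂, h1, hz]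
      push_cast
      simp

theorem exists_int_nums_dens_of (v : ℝ) (n : ℕ) :
    ∃ a b : ℤ, (GenContFract.of v).nums n = a ∧ (GenContFract.of v).dens n = b := by
  obtain ⟨a, b, h⟩ := (exists_int_contsAux_of v n).2
  exact ⟨a, b, by rw [num_eq_conts_a, nth_cont_eq_succ_nth_contAux, h],
    by rw [den_eq_conts_b, nth_cont_eq_succ_nth_contAux, h]⟩

theorem of_dens_add_le {v : ℝ} (n : ℕ) (h : ¬ (GenContFract.of v).TerminatedAt (n + 1)) :
    (GenContFract.of v).dens n + (GenContFract.of v).dens (n + 1) ≤ (GenContFract.of v).dens (n + 2) := by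
  obtain ⟨gp, hs⟩ : ∃ gp, (GenContFract.of v).s.get? (n + 1) = some gp := Option.ne_none_iff_exists'.1 h
  rw [dens_recurrence hs rfl rfl, (of_partNum_eq_one_and_exists_int_partDen_eq hs).1]
  have h1 : 1 ≤ gp.b := of_one_le_get?_partDen (partDen_eq_s_b hs)
  have h2 : 0 ≤ (GenContFract.of v).dens (n + 1) := zero_le_of_den
  nlinarith

end GenContFract

/-- A linear combination of two reals of opposite signs, with integer coefficients of
opposite signs, is at least as large as the first one. -/
theorem abs_le_abs_int_combination {e f : ℝ} {u v : ℤ} (hef : e * f ≤ 0) (hu : u ≠ 0)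
    (huv : u * v ≤ 0) : |e| ≤ |u * e + v * f| := by
  have h1 : (1 : ℝ) ≤ |(u : ℝ)| := by exact_mod_cast Int.one_le_abs hu
  -- The two terms have the same sign, so they cannot cancel.
  have h2 : (0 : ℝ) ≤ (u * e) * (v * f) := by
    have : ((u * v : ℤ) : ℝ) ≤ 0 := by exact_mod_cast huv
    push_cast at this
    nlinarith [mul_nonneg_of_nonpos_of_nonpos this hef]
  have h3 : |(u : ℝ) * e| ≤ |u * e + v * f| := by
    rw [← sq_le_sq]
    nlinarith [sq_nonneg ((v : ℝ) * f)]
  rw [abs_mul] at h3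
  nlinarith [abs_nonneg e]

/-- A lower bound for the error `e = q α - p` of a convergent, where `e' = q' α - p'` is the error
of the next one. -/
theorem half_inv_le_abs_of_det {e e' : ℝ} {q q' : ℝ} (hq : 0 < q) (hqq' : q ≤ q')
    (hdet : |q' * e - q * e'| = 1) (hee' : |e'| ≤ |e|) : 1 / (2 * q') ≤ |e| := by
  have h := abs_sub (q' * e) (q * e')
  rw [hdet, abs_mul, abs_mul, abs_of_pos hq, abs_of_pos (hq.trans_le hqq')] at h
  rw [div_le_iff₀ (by linarith)]
  nlinarith [abs_nonneg e, abs_nonneg e', mul_le_mul hqq' hee' (abs_nonneg _) (hq.le.trans hqq')]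

/-- Everything follows from the determinant identity and the alternation in sign of the errors `e n
= b n * α - p n`. Separation is the best approximation property: a pair `(j, m)` is expanded in the
unimodular basis of two consecutive convergents, and for `0 < j < b (n + 1)` the coefficients have
opposite signs, as do the errors. -/
theorem exists_isDenomSeq {α : ℝ} (hα : Irrational α) :
    ∃ q : ℕ → ℕ, (∀ n, cfDen α n = q n) ∧ IsDenomSeq α q := by
  choose p b hp hb using GenContFract.exists_int_nums_dens_of α
  have hnt := GenContFract.of_not_terminatedAt_of_irrational hα
  have hb1 : ∀ n, 1 ≤ b n := by
    intro n
    have h0 : (1 : ℝ) ≤ b n := by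
      rw [← hb]
      induction n with
      | zero => simp
      | succ n ih => exact ih.trans GenContFract.of_den_mono
    exact_mod_cast h0
  have hmono : ∀ n, b n ≤ b (n + 1) := fun n => by
    have : (b n : ℝ) ≤ b (n + 1) := by rw [← hb, ← hb]; exact GenContFract.of_den_mono
    exact_mod_cast this
  have hadd : ∀ n, b n + b (n + 1) ≤ b (n + 2) := fun n => by
    have : (b n + b (n + 1) : ℝ) ≤ b (n + 2) := by
      rw [← hb, ← hb, ← hb]; exact GenContFract.of_dens_add_le n (hnt _)
    exact_mod_cast this
  have hdet : ∀ n, p n * b (n + 1) - b n * p (n + 1) = (-1) ^ (n + 1) := fun n => by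
    have := SimpContFract.determinant (s := SimpContFract.of α) (n := n) (hnt n)
    change (GenContFract.of α).nums n * (GenContFract.of α).dens (n + 1) -
      (GenContFract.of α).dens n * (GenContFract.of α).nums (n + 1) = _ at this
    rw [hp, hp, hb, hb] at this
    exact_mod_cast this
  have hbR : ∀ n, (1 : ℝ) ≤ b n := fun n => by exact_mod_cast hb1 n
  set e : ℕ → ℝ := fun n => b n * α - p n with he
  have hle : ∀ n, |e n| ≤ 1 / b (n + 1) := fun n => by
    have h := GenContFract.abs_sub_convs_le (hnt n)
    rw [GenContFract.conv_eq_num_div_den, hp, hb, hb] at h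
    have h0 := hbR n
    have h1 := hbR (n + 1)
    have h2 : e n = b n * (α - p n / b n) := by
      simp only [he]; field_simp
    rw [h2, abs_mul, abs_of_pos (by linarith)]
    calc (b n : ℝ) * |α - p n / b n| ≤ b n * (1 / (b n * b (n + 1))) := by gcongr
      _ = 1 / b (n + 1) := by field_simp
  have hdetR : ∀ n, (b (n + 1) : ℝ) * e n - b n * e (n + 1) = (-1) ^ n := fun n => by
    have : (p n * b (n + 1) - b n * p (n + 1) : ℝ) = (-1) ^ (n + 1) := by exact_mod_cast hdet n
    simp only [he]
    rw [pow_succ] at this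
    linear_combination -this
  -- In `hdetR` the term `b n * e (n + 1)` has modulus less than `1`, so `b (n + 1) * e n` has the
  -- sign of the right-hand side.
  have hsign : ∀ n, 0 < (-1) ^ n * e n := fun n => by
    have h0 := hbR n
    have h1 := hbR (n + 1)
    have h2 := hbR (n + 2)
    have hlt : (b n : ℝ) < b (n + 2) := by
      have := hadd n; have := hb1 (n + 1); exact_mod_cast (by linarith : b n < b (n + 2))
    have h3 : |b n * e (n + 1)| < 1 := by
      rw [abs_mul, abs_of_pos (by linarith)]
      calc (b n : ℝ) * |e (n + 1)| ≤ b n * (1 / b (n + 2)) := by gcongr; exact hle (n + 1)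
        _ < 1 := by rw [mul_one_div, div_lt_one (by linarith)]; exact hlt
    have h4 := hdetR n
    rw [abs_lt] at h3
    rcases neg_one_pow_eq_or ℝ n with h | h <;> rw [h] at h4 ⊢ <;> nlinarith
  have hopp : ∀ n, e n * e (n + 1) ≤ 0 := fun n => by
    have h1 := hsign n
    have h2 := hsign (n + 1)
    rw [pow_succ] at h2
    rcases neg_one_pow_eq_or ℝ n with h | h <;> rw [h] at h1 h2 <;> nlinarith
  -- best approximation property of the convergents
  have hbest : ∀ n (j : ℤ) (m : ℤ), 0 < j → j < b (n + 1) → |e n| ≤ |j * α - m| := by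
    intro n j m hj0 hj
    set s : ℤ := (-1) ^ (n + 1) with hs
    have hs2 : s * s = 1 := by
      rcases neg_one_pow_eq_or ℤ (n + 1) with h | h <;> rw [hs, h] <;> norm_num
    -- Cramer's rule: `(j, m) = u (b n, p n) + v (b (n + 1), p (n + 1))`, with determinant `±1`.
    set u : ℤ := s * (m * b (n + 1) - j * p (n + 1)) with hu
    set v : ℤ := s * (j * p n - m * b n) with hv
    have hd := hdet n
    have hj' : j = u * b n + v * b (n + 1) := by
      have : u * b n + v * b (n + 1) = s * j * (p n * b (n + 1) - b n * p (n + 1)) := by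
        rw [hu, hv]; ring
      rw [this, hd]; linear_combination -j * hs2
    have hm' : m = u * p n + v * p (n + 1) := by
      have : u * p n + v * p (n + 1) = s * m * (p n * b (n + 1) - b n * p (n + 1)) := by
        rw [hu, hv]; ring
      rw [this, hd]; linear_combination -m * hs2
    have hjm : (j : ℝ) * α - m = u * e n + v * e (n + 1) := by
      have h1 : (j : ℝ) = u * b n + v * b (n + 1) := by exact_mod_cast hj'
      have h2 : (m : ℝ) = u * p n + v * p (n + 1) := by exact_mod_cast hm'
      rw [h1, h2]; simp only [he]; ring
    have hbn := hb1 n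
    have hbn1 := hb1 (n + 1)
    rw [hjm]
    apply abs_le_abs_int_combination (hopp n)
    · intro h0
      rw [h0, zero_mul, zero_add] at hj'
      have : 0 < v := by by_contra hc; push Not at hc; nlinarith
      nlinarith
    -- If `u` and `v` had the same strict sign, `j` would be negative or at least `b (n + 1)`.
    · by_contra hc
      push Not at hc
      rcases pos_and_pos_or_neg_and_neg_of_mul_pos hc with ⟨h1, h2⟩ | ⟨h1, h2⟩ <;> nlinarith
  have hanti : ∀ n, |e (n + 1)| ≤ |e n| := fun n => by
    have h1 := hdetR n
    have h2 := hdetR (n + 1)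
    have hb' : b n ≤ b (n + 2) := (hmono n).trans (hmono _)
    have hs1 := hsign n
    have hs2 := hsign (n + 1)
    have h3 := hle (n + 1)
    have hbb := hbR (n + 1)
    have hbb2 := hbR (n + 2)
    have hbb0 := hbR n
    have hadd' : (b n + b (n + 1) : ℝ) ≤ b (n + 2) := by exact_mod_cast hadd n
    -- Alternation turns the determinant into a sum of absolute values. Compared with `(b n + b (n +
    -- 1)) |e (n + 1)| ≤ 1`, it shows that the errors decrease.
    have hA : (b (n + 1) : ℝ) * |e n| + b n * |e (n + 1)| = 1 := by
      rw [pow_succ] at hs2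
      rcases neg_one_pow_eq_or ℝ n with h | h <;> rw [h] at hs1 hs2 h1
      · rw [abs_of_pos (by linarith), abs_of_neg (by linarith)]; linarith
      · rw [abs_of_neg (by linarith), abs_of_pos (by linarith)]; linarith
    rw [le_div_iff₀ (by linarith)] at h3
    nlinarith [abs_nonneg (e (n + 1)), mul_le_mul_of_nonneg_left hadd' (abs_nonneg (e (n + 1)))]
  have hcast : ∀ n, ((b n).toNat : ℤ) = b n := fun n => Int.toNat_of_nonneg (by linarith [hb1 n])
  have hcastR : ∀ n, ((b n).toNat : ℝ) = b n := fun n => by exact_mod_cast congrArg (Int.cast : ℤ → ℝ) (hcast n)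
  refine ⟨fun n => (b n).toNat, fun n => by rw [cfDen, hb, hcastR], ?_, ?_, ?_, ?_, ?_⟩
  · intro n; have := hb1 n; zify; rw [hcast]; linarith
  · intro n; zify; rw [hcast, hcast]; exact hmono n
  · intro n; zify; rw [hcast, hcast, hcast]; exact hadd n
  · intro n
    refine ⟨p n, ?_, by rw [hcastR, hcastR]; exact hle n⟩
    rw [hcast]
    refine ⟨(-1) ^ (n + 1) * b (n + 1), -(-1) ^ (n + 1) * p (n + 1), ?_⟩
    have := hdet n
    rcases neg_one_pow_eq_or ℤ (n + 1) with h | h <;> rw [h] at this ⊢ <;> linarith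
  · intro n j hj0 hj
    rw [hcastR, UnitAddCircle.norm_eq]
    have hj' : (j : ℤ) < b (n + 1) := by rw [← hcast]; exact_mod_cast hj
    have h := hbest n j (round ((j : ℝ) * α)) (by exact_mod_cast hj0) hj'
    refine le_trans ?_ (by exact_mod_cast h)
    refine half_inv_le_abs_of_det (q := b n) (e' := e (n + 1)) (by linarith [hbR n])
      (by exact_mod_cast hmono n) ?_ (hanti n)
    rw [hdetR]; simp

/-! ### The orbit, and `phi` compared with the distance to the origin -/

/-- The point `k α mod 1` of the torus. -/
noncomputable def orbitPoint (α : ℝ) (k : ℕ) : UnitAddCircle := (((k : ℝ) * α : ℝ) : UnitAddCircle)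

theorem orbitPoint_add (α : ℝ) (j k : ℕ) :
    orbitPoint α (j + k) = orbitPoint α j + orbitPoint α k := by
  simp only [orbitPoint, ← AddCircle.coe_add]; push_cast; ring_nf

theorem torusRotation_iterate (α : ℝ) (k : ℕ) (x : UnitAddCircle) :
    (torusRotation α)^[k] x = x + orbitPoint α k := by
  induction k with
  | zero => simp [orbitPoint]
  | succ k ih =>
    rw [Function.iterate_succ_apply', ih, torusRotation, orbitPoint_add, add_assoc]
    simp [orbitPoint]

theorem birkhoffSum_torusRotation (α : ℝ) (N : ℕ) (x : UnitAddCircle) :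
    birkhoffSum (torusRotation α) phi N x = ∑ k ∈ Finset.range N, phi (x + orbitPoint α k) := by
  simp only [birkhoffSum, torusRotation_iterate]

theorem UnitAddCircle.exists_coe_eq_abs_eq_norm (x : UnitAddCircle) :
    ∃ u : ℝ, (u : UnitAddCircle) = x ∧ |u| = ‖x‖ := by
  induction x using QuotientAddGroup.induction_on with
  | H r =>
    refine ⟨r - round r, ?_, (UnitAddCircle.norm_eq).symm⟩
    have : ((round r : ℝ) : UnitAddCircle) = 0 := by
      rw [AddCircle.coe_eq_zero_iff]; exact ⟨round r, by simp⟩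
    rw [AddCircle.coe_sub, this, sub_zero]

theorem UnitAddCircle.norm_coe_le_abs (u : ℝ) : ‖(u : UnitAddCircle)‖ ≤ |u| := by
  rw [UnitAddCircle.norm_eq]
  simpa using round_le u 0

theorem UnitAddCircle.norm_coe_of_mem_Ico {r : ℝ} (h0 : 0 ≤ r) (h1 : r < 1) :
    ‖(r : UnitAddCircle)‖ = min r (1 - r) := by
  rw [UnitAddCircle.norm_eq, abs_sub_round_eq_min, Int.fract_eq_self.2 ⟨h0, h1⟩]

theorem phi_coe_of_mem_Ico {r : ℝ} (h0 : 0 ≤ r) (h1 : r < 1) :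
    phi (r : UnitAddCircle) = 1 / r + 1 / (1 - r) := by
  have : ((AddCircle.equivIco (1 : ℝ) 0 (r : UnitAddCircle) : Set.Ico (0 : ℝ) (0 + 1)) : ℝ) = r := by
    rw [AddCircle.coe_equivIco_mk_apply]; simp [Int.fract_eq_self.2 ⟨h0, h1⟩]
  rw [phi, this]

theorem UnitAddCircle.exists_coe_mem_Ico (x : UnitAddCircle) :
    ∃ r : ℝ, 0 ≤ r ∧ r < 1 ∧ (r : UnitAddCircle) = x := by
  obtain ⟨r, hr, h⟩ := AddCircle.eq_coe_Ico (p := (1 : ℝ)) x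
  exact ⟨r, hr.1, hr.2, h⟩

theorem inv_norm_le_phi {x : UnitAddCircle} (hx : x ≠ 0) : 1 / ‖x‖ ≤ phi x := by
  obtain ⟨r, h0, h1, rfl⟩ := UnitAddCircle.exists_coe_mem_Ico x
  have hr : 0 < r := lt_of_le_of_ne h0 (by rintro rfl; simp at hx)
  rw [phi_coe_of_mem_Ico h0 h1, UnitAddCircle.norm_coe_of_mem_Ico h0 h1]
  have h2 : 0 < 1 / r := by positivity
  have h3 : 0 < 1 / (1 - r) := by have : 0 < 1 - r := by linarith
                                  positivity
  rcases min_choice r (1 - r) with h | h <;> rw [h] <;> linarith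

theorem phi_le_two_div_norm {x : UnitAddCircle} (hx : x ≠ 0) : phi x ≤ 2 / ‖x‖ := by
  obtain ⟨r, h0, h1, rfl⟩ := UnitAddCircle.exists_coe_mem_Ico x
  have hr : 0 < r := lt_of_le_of_ne h0 (by rintro rfl; simp at hx)
  have hr' : 0 < 1 - r := by linarith
  rw [phi_coe_of_mem_Ico h0 h1, UnitAddCircle.norm_coe_of_mem_Ico h0 h1]
  have hm : 0 < min r (1 - r) := lt_min hr hr'
  have h2 : 1 / r ≤ 1 / min r (1 - r) := one_div_le_one_div_of_le hm (min_le_left _ _)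
  have h3 : 1 / (1 - r) ≤ 1 / min r (1 - r) := one_div_le_one_div_of_le hm (min_le_right _ _)
  calc _ ≤ 1 / min r (1 - r) + 1 / min r (1 - r) := add_le_add h2 h3
    _ = _ := by ring

/-- The convention `1 / 0 = 0` gives `phi 0 = 1`, so the origin is no exception. The resulting bound
`N ≤ S_N` makes Birkhoff sums positive and unbounded at every point. -/
theorem one_le_phi (x : UnitAddCircle) : 1 ≤ phi x := by
  obtain ⟨r, h0, h1, rfl⟩ := UnitAddCircle.exists_coe_mem_Ico x
  rw [phi_coe_of_mem_Ico h0 h1]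
  have h2 : 0 ≤ 1 / r := by positivity
  have h3 : 1 ≤ 1 / (1 - r) := by rw [le_div_iff₀ (by linarith)]; linarith
  linarith

theorem natCast_le_sum_phi (α : ℝ) (N : ℕ) (x : UnitAddCircle) :
    (N : ℝ) ≤ ∑ k ∈ Finset.range N, phi (x + orbitPoint α k) := by
  calc (N : ℝ) = ∑ k ∈ Finset.range N, (1 : ℝ) := by simp
    _ ≤ _ := Finset.sum_le_sum fun _ _ => one_le_phi _

/-! ### Sums of reciprocals over separated sets -/

/-- The elements up to `K` contribute at most a harmonic sum; the others are at most `K` in number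
and contribute at most `1 / K` each. -/
theorem sum_inv_natCast_le {F : Finset ℕ} {K : ℕ} (hK : 1 ≤ K) (hF : F.card ≤ K)
    (h1 : ∀ k ∈ F, 1 ≤ k) : ∑ k ∈ F, (1 : ℝ) / k ≤ 2 + Real.log K := by
  have hKR : (1 : ℝ) ≤ K := by exact_mod_cast hK
  have hpt : ∀ k ∈ F, (1 : ℝ) / k ≤ (if k ≤ K then (1 : ℝ) / k else 0) + 1 / K := by
    intro k hk
    split_ifs with h
    · have : (0 : ℝ) ≤ 1 / K := by positivity
      linarith
    · rw [zero_add]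
      exact one_div_le_one_div_of_le (by linarith) (by exact_mod_cast (not_le.1 h).le)
  have hharm : ∑ k ∈ F, (if k ≤ K then (1 : ℝ) / k else 0) ≤ 1 + Real.log K := by
    rw [← Finset.sum_filter]
    have hh := harmonic_le_one_add_log K
    rw [harmonic_eq_sum_Icc] at hh
    push_cast at hh
    refine le_trans ?_ hh
    simp only [one_div]
    refine Finset.sum_le_sum_of_subset_of_nonneg ?_ fun _ _ _ => by positivity
    intro k hk
    rw [Finset.mem_filter] at hk
    exact Finset.mem_Icc.2 ⟨h1 k hk.1, hk.2⟩
  calc ∑ k ∈ F, (1 : ℝ) / k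
      ≤ ∑ k ∈ F, ((if k ≤ K then (1 : ℝ) / k else 0) + 1 / K) := Finset.sum_le_sum hpt
    _ = ∑ k ∈ F, (if k ≤ K then (1 : ℝ) / k else 0) + F.card * (1 / K) := by
      rw [Finset.sum_add_distrib]; simp
    _ ≤ (1 + Real.log K) + 1 := by
      refine add_le_add hharm ?_
      rw [mul_one_div, div_le_one (by linarith)]
      exact_mod_cast hF
    _ = 2 + Real.log K := by ring

/-- The integers `⌊u i / δ⌋` are positive and, by separation, distinct, which reduces the sum to one
over a set of positive integers. -/
theorem sum_inv_le_of_separated {ι : Type*} {F : Finset ι} {u : ι → ℝ} {δ : ℝ} (hδ : 0 < δ)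
    (h1 : ∀ i ∈ F, δ ≤ u i) (h2 : ∀ i ∈ F, ∀ j ∈ F, i ≠ j → δ ≤ |u i - u j|)
    {K : ℕ} (hK : 1 ≤ K) (hF : F.card ≤ K) :
    ∑ i ∈ F, 1 / u i ≤ 1 / δ * (2 + Real.log K) := by
  classical
  set k : ι → ℕ := fun i => ⌊u i / δ⌋₊ with hk
  have hk1 : ∀ i ∈ F, 1 ≤ k i := fun i hi => Nat.le_floor (by
    rw [Nat.cast_one, le_div_iff₀ hδ]; linarith [h1 i hi])
  have hinj : Set.InjOn k F := by
    intro i hi j hj hij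
    by_contra hne
    have ha := h2 i hi j hj hne
    have hi0 : 0 ≤ u i / δ := div_nonneg (hδ.le.trans (h1 i hi)) hδ.le
    have hj0 : 0 ≤ u j / δ := div_nonneg (hδ.le.trans (h1 j hj)) hδ.le
    have e1 := Nat.floor_le hi0
    have e2 := Nat.lt_floor_add_one (u i / δ)
    have e3 := Nat.floor_le hj0
    have e4 := Nat.lt_floor_add_one (u j / δ)
    simp only [hk] at hij
    rw [hij] at e1 e2
    have : |u i / δ - u j / δ| < 1 := by rw [abs_lt]; constructor <;> linarith
    rw [← sub_div, abs_div, abs_of_pos hδ, div_lt_one hδ] at this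
    linarith
  calc ∑ i ∈ F, 1 / u i ≤ ∑ i ∈ F, 1 / δ * (1 / (k i : ℝ)) := by
        refine Finset.sum_le_sum fun i hi => ?_
        rw [one_div_mul_one_div]
        have : (1 : ℝ) ≤ k i := by exact_mod_cast hk1 i hi
        refine one_div_le_one_div_of_le (by positivity) ?_
        have e1 := Nat.floor_le (div_nonneg (hδ.le.trans (h1 i hi)) hδ.le)
        rw [le_div_iff₀ hδ] at e1
        linarith
    _ = 1 / δ * ∑ m ∈ F.image k, 1 / (m : ℝ) := by
        rw [← Finset.mul_sum, Finset.sum_image hinj]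
    _ ≤ 1 / δ * (2 + Real.log K) := by
        gcongr
        refine sum_inv_natCast_le hK (Finset.card_image_le.trans hF) ?_
        intro m hm
        obtain ⟨i, hi, rfl⟩ := Finset.mem_image.1 hm
        exact hk1 i hi

theorem sum_inv_norm_le_of_separated {ι : Type*} {F : Finset ι} {z : ι → UnitAddCircle} {δ : ℝ}
    (hδ : 0 < δ) (h1 : ∀ i ∈ F, δ ≤ ‖z i‖) (h2 : ∀ i ∈ F, ∀ j ∈ F, i ≠ j → δ ≤ ‖z i - z j‖)
    {K : ℕ} (hK : 1 ≤ K) (hF : F.card ≤ K) :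
    ∑ i ∈ F, 1 / ‖z i‖ ≤ 2 / δ * (2 + Real.log K) := by
  choose u hu hun using fun i => UnitAddCircle.exists_coe_eq_abs_eq_norm (z i)
  have hsep : ∀ i ∈ F, ∀ j ∈ F, i ≠ j → δ ≤ |u i - u j| := fun i hi j hj hij => by
    refine (h2 i hi j hj hij).trans ?_
    rw [← hu, ← hu, ← AddCircle.coe_sub]
    exact UnitAddCircle.norm_coe_le_abs _
  have hpos := sum_inv_le_of_separated (F := F.filter fun i => 0 ≤ u i) (u := u) hδ
    (fun i hi => by
      rw [Finset.mem_filter] at hi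
      rw [← abs_of_nonneg hi.2, hun]; exact h1 i hi.1)
    (fun i hi j hj => hsep i (Finset.mem_filter.1 hi).1 j (Finset.mem_filter.1 hj).1) hK
    ((Finset.card_filter_le _ _).trans hF)
  have hneg := sum_inv_le_of_separated (F := F.filter fun i => ¬ 0 ≤ u i) (u := fun i => - u i) hδ
    (fun i hi => by
      rw [Finset.mem_filter] at hi
      rw [← abs_of_neg (not_le.1 hi.2), hun]; exact h1 i hi.1)
    (fun i hi j hj hij => by
      have := hsep i (Finset.mem_filter.1 hi).1 j (Finset.mem_filter.1 hj).1 hij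
      change δ ≤ |-u i - -u j|
      rwa [← abs_neg, show -(-u i - -u j) = u i - u j by ring]) hK
    ((Finset.card_filter_le _ _).trans hF)
  -- The two sides of the origin are treated separately, whence the factor `2 / δ`.
  rw [← Finset.sum_filter_add_sum_filter_not F (fun i => 0 ≤ u i)]
  have e1 : ∑ i ∈ F.filter (fun i => 0 ≤ u i), 1 / ‖z i‖ = ∑ i ∈ F.filter (fun i => 0 ≤ u i), 1 / u i :=
    Finset.sum_congr rfl fun i hi => by rw [← hun, abs_of_nonneg (Finset.mem_filter.1 hi).2]
  have e2 : ∑ i ∈ F.filter (fun i => ¬ 0 ≤ u i), 1 / ‖z i‖ =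
      ∑ i ∈ F.filter (fun i => ¬ 0 ≤ u i), 1 / (- u i) :=
    Finset.sum_congr rfl fun i hi => by
      rw [← hun, abs_of_neg (not_le.1 (Finset.mem_filter.1 hi).2)]
  rw [e1, e2]
  calc _ ≤ 1 / δ * (2 + Real.log K) + 1 / δ * (2 + Real.log K) := add_le_add hpos hneg
    _ = _ := by ring

/-! ### Bounds for Birkhoff sums -/

namespace IsDenomSeq

variable {α : ℝ} {q : ℕ → ℕ}

theorem one_le_cast (H : IsDenomSeq α q) (n : ℕ) : (1 : ℝ) ≤ q n := by exact_mod_cast H.pos n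

theorem monotone (H : IsDenomSeq α q) : Monotone q := monotone_nat_of_le_succ H.mono'

theorem cast_mono (H : IsDenomSeq α q) {m n : ℕ} (h : m ≤ n) : (q m : ℝ) ≤ q n := by
  exact_mod_cast H.monotone h

theorem norm_orbitPoint_sub_ge (H : IsDenomSeq α q) (n : ℕ) {j k : ℕ} (hjk : j ≠ k)
    (h1 : j < k + q (n + 1)) (h2 : k < j + q (n + 1)) :
    1 / (2 * q (n + 1) : ℝ) ≤ ‖orbitPoint α j - orbitPoint α k‖ := by
  wlog h : k < j generalizing j k
  · rw [norm_sub_rev]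
    exact this hjk.symm h2 h1 (lt_of_le_of_ne (not_lt.1 h) hjk)
  obtain ⟨d, rfl⟩ := Nat.exists_eq_add_of_lt h
  rw [add_assoc, orbitPoint_add, add_sub_cancel_left]
  exact H.sep n (d + 1) (by omega) (by omega)

/-- Points are split by distance `1/(4Q)` to the origin. A block of `Q` consecutive times has
`1/(2Q)`-separated points, so its far points contribute `O(Q log Q)`, and it contains at most one
near point. The near points of all blocks are still `1/(2Q')`-separated, and `hx` keeps them away
from the origin, since they are separated from the point at time `N`, which is close to it. -/
theorem birkhoff_upper_bound (H : IsDenomSeq α q) (n : ℕ) {N : ℕ} (hN : q (n + 1) ≤ N)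
    (hN' : N < q (n + 2)) {x : UnitAddCircle}
    (hx : ‖x + orbitPoint α N‖ ≤ 1 / (4 * q (n + 2))) :
    ∑ k ∈ Finset.range N, phi (x + orbitPoint α k) ≤
      32 * N * (2 + Real.log (q (n + 1))) + 16 * q (n + 2) * (2 + Real.log (N / q (n + 1) + 1)) := by
  set Q := q (n + 1) with hQ
  set Q' := q (n + 2) with hQ'
  have hQ1 : (1 : ℝ) ≤ Q := H.one_le_cast _
  have hQ'1 : (1 : ℝ) ≤ Q' := H.one_le_cast _
  have hQpos : 0 < Q := H.pos _
  have hQ'2 : q (n + 1 + 1) = Q' := rfl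
  set z : ℕ → UnitAddCircle := fun k => x + orbitPoint α k with hz
  have hzsub : ∀ j k, z j - z k = orbitPoint α j - orbitPoint α k := fun j k => by
    simp only [hz]; abel
  have hlow : ∀ k ∈ Finset.range N, 1 / (4 * Q' : ℝ) ≤ ‖z k‖ := by
    intro k hk
    rw [Finset.mem_range] at hk
    have h1 := H.norm_orbitPoint_sub_ge (n + 1) (j := N) (k := k) (by omega) (by omega) (by omega)
    rw [← hzsub] at h1
    have h2 := norm_sub_le (z N) (z k)
    have h3 : 1 / (2 * Q' : ℝ) = 1 / (4 * Q') + 1 / (4 * Q') := by field_simp; norm_num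
    have h4 : ‖z N‖ ≤ 1 / (4 * Q') := hx
    linarith
  have hzne : ∀ k ∈ Finset.range N, z k ≠ 0 := fun k hk h0 => by
    have := hlow k hk
    rw [h0, norm_zero] at this
    have : (0 : ℝ) < 1 / (4 * Q') := by positivity
    linarith
  set near := (Finset.range N).filter fun k => ‖z k‖ < 1 / (4 * Q : ℝ) with hnear
  set far := (Finset.range N).filter fun k => ¬ ‖z k‖ < 1 / (4 * Q : ℝ) with hfar
  have hblock : ∀ j k, j / Q = k / Q → j ≠ k → 1 / (2 * Q : ℝ) ≤ ‖z j - z k‖ := by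
    intro j k hjk hne
    have e1 := Nat.div_add_mod j Q
    have e2 := Nat.div_add_mod k Q
    have e3 := Nat.mod_lt j hQpos
    have e4 := Nat.mod_lt k hQpos
    rw [hjk] at e1
    rw [hzsub]
    exact H.norm_orbitPoint_sub_ge n hne (by omega) (by omega)
  have hnearcard : near.card ≤ N / Q + 1 := by
    rw [← Finset.card_range (N / Q + 1)]
    refine Finset.card_le_card_of_injOn (fun k => k / Q) ?_ ?_
    · intro k hk
      have hk' : k < N := Finset.mem_range.1 (Finset.mem_filter.1 hk).1
      exact Finset.mem_coe.2 (Finset.mem_range.2 (Nat.lt_succ_of_le (Nat.div_le_div_right hk'.le)))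
    · intro j hj k hk hjk
      by_contra hne
      have h1 := hblock j k hjk hne
      have h2 := norm_sub_le (z j) (z k)
      have h3 := (Finset.mem_filter.1 hj).2
      have h4 := (Finset.mem_filter.1 hk).2
      have h5 : 1 / (2 * Q : ℝ) = 1 / (4 * Q) + 1 / (4 * Q) := by field_simp; norm_num
      linarith
  have hsumnear : ∑ k ∈ near, 1 / ‖z k‖ ≤ 8 * Q' * (2 + Real.log (N / Q + 1)) := by
    have := sum_inv_norm_le_of_separated (F := near) (z := z) (δ := 1 / (4 * Q')) (by positivity)
      (fun k hk => hlow k (Finset.mem_filter.1 hk).1)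
      (fun j hj k hk hjk => by
        have hj' := Finset.mem_range.1 (Finset.mem_filter.1 hj).1
        have hk' := Finset.mem_range.1 (Finset.mem_filter.1 hk).1
        have h1 := H.norm_orbitPoint_sub_ge (n + 1) hjk (by omega) (by omega)
        rw [← hzsub] at h1
        refine le_trans ?_ h1
        exact one_div_le_one_div_of_le (by positivity) (by linarith)) (K := N / Q + 1) (Nat.succ_pos _)
      hnearcard
    refine this.trans ?_
    have e : 2 / (1 / (4 * Q' : ℝ)) = 8 * Q' := by field_simp; norm_num
    rw [e]
    gcongr
    push_cast
    gcongr
    exact Nat.cast_div_le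
  have hsumfar : ∑ k ∈ far, 1 / ‖z k‖ ≤ 16 * N * (2 + Real.log Q) := by
    have hmaps : ∀ k ∈ far, k / Q ∈ Finset.range (N / Q + 1) := fun k hk => by
      have hk' : k < N := Finset.mem_range.1 (Finset.mem_filter.1 hk).1
      exact Finset.mem_range.2 (Nat.lt_succ_of_le (Nat.div_le_div_right hk'.le))
    rw [← Finset.sum_fiberwise_of_maps_to hmaps]
    have hfib : ∀ b ∈ Finset.range (N / Q + 1),
        ∑ k ∈ far.filter (fun k => k / Q = b), 1 / ‖z k‖ ≤ 8 * Q * (2 + Real.log Q) := by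
      intro b _
      have := sum_inv_norm_le_of_separated (F := far.filter (fun k => k / Q = b)) (z := z)
        (δ := 1 / (4 * Q)) (by positivity)
        (fun k hk => not_lt.1 (Finset.mem_filter.1 (Finset.mem_filter.1 hk).1).2)
        (fun j hj k hk hjk => by
          refine le_trans ?_ (hblock j k ((Finset.mem_filter.1 hj).2.trans
            (Finset.mem_filter.1 hk).2.symm) hjk)
          exact one_div_le_one_div_of_le (by positivity) (by linarith)) (K := Q) hQpos
        (by
          refine (Finset.card_le_card_of_injOn (t := Finset.range Q) (fun k => k % Q) ?_ ?_).trans_eq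
            (Finset.card_range Q)
          · intro k _
            exact Finset.mem_coe.2 (Finset.mem_range.2 (Nat.mod_lt _ hQpos))
          · intro j hj k hk hjk
            have h1 := (Finset.mem_filter.1 hj).2
            have h2 := (Finset.mem_filter.1 hk).2
            have e1 := Nat.div_add_mod j Q
            have e2 := Nat.div_add_mod k Q
            simp only at hjk
            rw [h1, hjk] at e1
            rw [h2] at e2
            omega)
      refine this.trans (le_of_eq ?_)
      have e : 2 / (1 / (4 * Q : ℝ)) = 8 * Q := by field_simp; norm_num
      rw [e]
    refine (Finset.sum_le_sum hfib).trans ?_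
    rw [Finset.sum_const, Finset.card_range, nsmul_eq_mul]
    have hlog : 0 ≤ Real.log Q := Real.log_nonneg hQ1
    -- The incomplete last block costs a factor 2, because `Q ≤ N`.
    have hNQ : ((N / Q + 1 : ℕ) : ℝ) * Q ≤ 2 * N := by
      have h1 := Nat.div_mul_le_self N Q
      have : (N / Q + 1) * Q ≤ 2 * N := by rw [add_mul]; omega
      exact_mod_cast this
    calc ((N / Q + 1 : ℕ) : ℝ) * (8 * Q * (2 + Real.log Q))
        = 8 * (((N / Q + 1 : ℕ) : ℝ) * Q) * (2 + Real.log Q) := by ring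
      _ ≤ 8 * (2 * N) * (2 + Real.log Q) := by gcongr
      _ = _ := by ring
  calc ∑ k ∈ Finset.range N, phi (z k) ≤ ∑ k ∈ Finset.range N, 2 * (1 / ‖z k‖) :=
        Finset.sum_le_sum fun k hk => (phi_le_two_div_norm (hzne k hk)).trans (by
          rw [mul_one_div])
    _ = 2 * (∑ k ∈ near, 1 / ‖z k‖ + ∑ k ∈ far, 1 / ‖z k‖) := by
        rw [← Finset.mul_sum, Finset.sum_filter_add_sum_filter_not]
    _ ≤ _ := by linarith

theorem _root_.log_half_add_one_le_sum (Q : ℕ) :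
    Real.log ((Q + 2) / 2) ≤ ∑ m ∈ Finset.range Q, 1 / ((m : ℝ) + 2) := by
  induction Q with
  | zero => simp
  | succ Q ih =>
    rw [Finset.sum_range_succ]
    have h1 : (((Q + 1 : ℕ) : ℝ) + 2) / 2 = (Q + 2) / 2 * (1 + 1 / (Q + 2)) := by
      push_cast; field_simp; ring
    have h2 : (0 : ℝ) < 1 + 1 / (Q + 2) := by positivity
    rw [h1, Real.log_mul (by positivity) h2.ne']
    linarith [Real.log_le_sub_one_of_pos h2]

theorem _root_.half_log_le_log_half_add_one {t : ℝ} (ht : 0 < t) :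
    Real.log t / 2 ≤ Real.log ((t + 2) / 2) := by
  have h : Real.log t ≤ Real.log (((t + 2) / 2) ^ 2) := Real.log_le_log ht (by nlinarith)
  rw [Real.log_pow] at h
  push_cast at h
  linarith

/-- Replace `α` by `p / Q` with `p` coprime to `Q`: then each interval `[g/Q, (g+1)/Q)` contains
exactly one of the first `Q` points. The true orbit drifts from this one by at most `1/Q`, so the
distances to the origin are at most `(g + 2)/Q` with `g` running over `0, …, Q - 1`. -/
theorem birkhoff_lower_bound_block (H : IsDenomSeq α q) (n : ℕ) {x : UnitAddCircle}
    (hx : ∀ k, x + orbitPoint α k ≠ 0) :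
    q n * Real.log (q n) / 2 ≤ ∑ k ∈ Finset.range (q n), phi (x + orbitPoint α k) := by
  set Q := q n with hQ
  have hQpos : 0 < Q := H.pos n
  have hQ1 : (1 : ℝ) ≤ Q := H.one_le_cast n
  obtain ⟨p, hcop, happrox⟩ := H.exists_approx n
  obtain ⟨r, -, -, rfl⟩ := UnitAddCircle.exists_coe_mem_Ico x
  set f : ℕ → ℝ := fun k => Int.fract (r + k * p / Q) with hf
  set g : ℕ → ℕ := fun k => ⌊Q * f k⌋₊ with hg
  have hf0 : ∀ k, 0 ≤ f k := fun k => Int.fract_nonneg _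
  have hfg : ∀ k, Q * f k < g k + 1 := fun k => Nat.lt_floor_add_one _
  have hgf : ∀ k, (g k : ℝ) ≤ Q * f k := fun k => Nat.floor_le (mul_nonneg (by linarith) (hf0 k))
  have hgmem : ∀ k ∈ Finset.range Q, g k ∈ Finset.range Q := fun k _ => by
    have h1 : f k < 1 := Int.fract_lt_one _
    have : (g k : ℝ) < Q := (hgf k).trans_lt (by nlinarith)
    exact Finset.mem_range.2 (by exact_mod_cast this)
  have hinj : Set.InjOn g (Finset.range Q) := by
    intro j hj k hk hjk
    have hj' : j < Q := Finset.mem_range.1 hj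
    have hk' : k < Q := Finset.mem_range.1 hk
    set m : ℤ := (j - k) * p - Q * (⌊r + j * p / Q⌋ - ⌊r + k * p / Q⌋) with hm
    have e : Q * f j - Q * f k = m := by
      simp only [hf, Int.fract, hm]; push_cast; field_simp; ring
    have h1 := hfg j
    have h2 := hgf j
    have h3 := hfg k
    have h4 := hgf k
    rw [hjk] at h1 h2
    have hlt : |(m : ℝ)| < 1 := by rw [← e, abs_lt]; constructor <;> linarith
    have hm0 : m = 0 := by
      rw [← Int.abs_lt_one_iff]; exact_mod_cast hlt
    have hdvd : (Q : ℤ) ∣ (j - k) * p := ⟨⌊r + j * p / Q⌋ - ⌊r + k * p / Q⌋, by linarith⟩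
    have hdvd' : (Q : ℤ) ∣ j - k := hcop.symm.dvd_of_dvd_mul_right hdvd
    have := Int.eq_zero_of_abs_lt_dvd hdvd' (by rw [abs_lt]; constructor <;> linarith)
    omega
  -- Injectivity of `g` on a finite set gives a bijection, so the sum can be reindexed.
  have himg : (Finset.range Q).image g = Finset.range Q :=
    Finset.eq_of_subset_of_card_le (Finset.image_subset_iff.2 hgmem)
      (by rw [Finset.card_image_of_injOn hinj])
  have hnorm : ∀ k ∈ Finset.range Q,
      ‖(r : UnitAddCircle) + orbitPoint α k‖ ≤ ((g k : ℝ) + 2) / Q := by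
    intro k hk
    have hk' : (k : ℝ) ≤ Q := by exact_mod_cast (Finset.mem_range.1 hk).le
    have e : (r : UnitAddCircle) + orbitPoint α k = ((f k + k * (Q * α - p) / Q : ℝ) : UnitAddCircle) := by
      rw [orbitPoint, ← AddCircle.coe_add, ← sub_eq_zero, ← AddCircle.coe_sub,
        AddCircle.coe_eq_zero_iff]
      refine ⟨⌊r + k * p / Q⌋, ?_⟩
      simp only [hf, Int.fract, zsmul_eq_mul, mul_one]
      field_simp
      ring
    rw [e]
    refine (UnitAddCircle.norm_coe_le_abs _).trans ((abs_add_le _ _).trans ?_)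
    rw [abs_of_nonneg (hf0 k), abs_div, abs_mul, Nat.abs_cast, Nat.abs_cast]
    have h1 : (1 : ℝ) / q (n + 1) ≤ 1 / Q :=
      one_div_le_one_div_of_le (by linarith) (H.cast_mono n.le_succ)
    have h2 : (k : ℝ) * |Q * α - p| ≤ 1 := by
      calc (k : ℝ) * |Q * α - p| ≤ Q * (1 / Q) := by
            gcongr; exact happrox.trans h1
        _ = 1 := by field_simp
    calc f k + k * |Q * α - p| / Q ≤ (g k + 1) / Q + 1 / Q := by
          gcongr
          rw [le_div_iff₀ (by linarith), mul_comm]; exact (hfg k).le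
      _ = _ := by ring
  calc Q * Real.log Q / 2 ≤ Q * Real.log ((Q + 2) / 2) := by
        have := half_log_le_log_half_add_one (t := Q) (by linarith)
        nlinarith
    _ ≤ Q * ∑ m ∈ Finset.range Q, 1 / ((m : ℝ) + 2) := by
        gcongr; exact log_half_add_one_le_sum Q
    _ = ∑ k ∈ Finset.range Q, Q * (1 / ((g k : ℝ) + 2)) := by
        rw [← Finset.mul_sum]
        conv_lhs => rw [← himg, Finset.sum_image hinj]
    _ ≤ _ := by
        refine Finset.sum_le_sum fun k hk => le_trans ?_ (inv_norm_le_phi (hx k))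
        have hpos : 0 < ‖(r : UnitAddCircle) + orbitPoint α k‖ := norm_pos_iff.2 (hx k)
        have := one_div_le_one_div_of_le hpos (hnorm k hk)
        rw [one_div_div] at this
        rwa [mul_one_div]

theorem birkhoff_lower_bound_mul (H : IsDenomSeq α q) (n b : ℕ) {x : UnitAddCircle}
    (hx : ∀ k, x + orbitPoint α k ≠ 0) :
    b * (q n * Real.log (q n) / 2) ≤ ∑ k ∈ Finset.range (b * q n), phi (x + orbitPoint α k) := by
  induction b with
  | zero => simp
  | succ b ih =>
    rw [add_mul, one_mul, Finset.sum_range_add]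
    have h := H.birkhoff_lower_bound_block n (x := x + orbitPoint α (b * q n)) (fun k => by
      rw [add_assoc, ← orbitPoint_add]; exact hx _)
    simp only [add_assoc, ← orbitPoint_add] at h
    push_cast
    linarith

theorem birkhoff_lower_bound (H : IsDenomSeq α q) (n : ℕ) {N : ℕ} (hN : q n ≤ N)
    {x : UnitAddCircle} (hx : ∀ k, x + orbitPoint α k ≠ 0) :
    N * Real.log (q n) / 4 ≤ ∑ k ∈ Finset.range N, phi (x + orbitPoint α k) := by
  have hQpos : 0 < q n := H.pos n
  have h1 := H.birkhoff_lower_bound_mul n (N / q n) hx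
  have h2 : ∑ k ∈ Finset.range (N / q n * q n), phi (x + orbitPoint α k) ≤
      ∑ k ∈ Finset.range N, phi (x + orbitPoint α k) :=
    Finset.sum_le_sum_of_subset_of_nonneg
      (Finset.range_subset_range.2 (Nat.div_mul_le_self _ _))
      fun _ _ _ => zero_le_one.trans (one_le_phi _)
  have h3 : (N : ℝ) ≤ 2 * ((N / q n : ℕ) * q n) := by
    have e := Nat.div_add_mod N (q n)
    have e1 := Nat.mod_lt N hQpos
    have e2 : q n * 1 ≤ q n * (N / q n) := Nat.mul_le_mul_left _ (Nat.div_pos hN hQpos)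
    have : N ≤ 2 * (N / q n * q n) := by rw [mul_comm (N / q n)]; omega
    exact_mod_cast this
  have hlog : 0 ≤ Real.log (q n) := Real.log_nonneg (H.one_le_cast n)
  nlinarith [mul_le_mul_of_nonneg_right h3 hlog]

end IsDenomSeq

/-! ### Measure of balls and the null set of orbits through the origin -/

open MeasureTheory Filter

theorem volume_norm_add_le (y : UnitAddCircle) {r s : ℝ} (hr : 2 * r ≤ s) :
    volume {x : UnitAddCircle | ‖x + y‖ ≤ r} ≤ ENNReal.ofReal s := by
  have : {x : UnitAddCircle | ‖x + y‖ ≤ r} = Metric.closedBall (-y) r := by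
    ext x; simp [Metric.mem_closedBall, dist_eq_norm]
  rw [this, AddCircle.volume_closedBall]
  exact ENNReal.ofReal_le_ofReal ((min_le_right _ _).trans hr)

theorem ae_add_orbitPoint_ne_zero (α : ℝ) :
    ∀ᵐ x : UnitAddCircle, ∀ k, x + orbitPoint α k ≠ 0 := by
  have : NullSingletonClass (volume : Measure UnitAddCircle) := ⟨fun x => by
    rw [← Metric.closedBall_zero, AddCircle.volume_closedBall]; simp⟩
  have h := (Set.countable_range fun k => - orbitPoint α k).ae_notMem
    (volume : Measure UnitAddCircle)
  filter_upwards [h] with x hx k hk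
  exact hx ⟨k, (eq_neg_of_add_eq_zero_left hk).symm⟩

/-! ### Comparison of harmonic sums with logarithms -/

theorem sum_Ico_inv_le {A B : ℕ} (hA : 1 ≤ A) (hAB : A ≤ B) :
    ∑ N ∈ Finset.Ico A B, (1 : ℝ) / N ≤ 1 / A + Real.log (B / A) := by
  have hA' : (1 : ℝ) ≤ A := by exact_mod_cast hA
  have key : ∀ B, A ≤ B → ∑ N ∈ Finset.Ico A (B + 1), (1 : ℝ) / N ≤ 1 / A + Real.log (B / A) := by
    intro B hB
    induction B, hB using Nat.le_induction with
    | base => simp [div_self (by linarith : (A : ℝ) ≠ 0)]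
    | succ B hB ih =>
      have hB' : (1 : ℝ) ≤ B := by exact_mod_cast hA.trans hB
      rw [Finset.sum_Ico_succ_top (by omega)]
      have h1 := Real.one_sub_inv_le_log_of_pos (x := ((B + 1 : ℕ) : ℝ) / B) (by positivity)
      have h2 : Real.log ((B + 1 : ℕ) / A) = Real.log (B / A) + Real.log (((B + 1 : ℕ) : ℝ) / B) := by
        rw [← Real.log_mul (by positivity) (by positivity)]
        congr 1; field_simp
      have h3 : 1 - (((B + 1 : ℕ) : ℝ) / B)⁻¹ = 1 / ((B + 1 : ℕ) : ℝ) := by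
        push_cast; field_simp; ring
      linarith
  rcases hAB.eq_or_lt with rfl | h
  · simp [div_self (by linarith : (A : ℝ) ≠ 0)]
  · obtain ⟨C, rfl⟩ : ∃ C, B = C + 1 := ⟨B - 1, by omega⟩
    have hC : A ≤ C := by omega
    have hC' : (1 : ℝ) ≤ C := by exact_mod_cast hA.trans hC
    refine (key C hC).trans ?_
    gcongr
    exact Nat.le_succ C

theorem log_div_le_sum_Ico_inv {A B : ℕ} (hA : 1 ≤ A) (hAB : A ≤ B) :
    Real.log (B / A) ≤ ∑ N ∈ Finset.Ico A B, (1 : ℝ) / N := by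
  have hA' : (1 : ℝ) ≤ A := by exact_mod_cast hA
  induction B, hAB using Nat.le_induction with
  | base => simp [div_self (by linarith : (A : ℝ) ≠ 0)]
  | succ B hB ih =>
    have hB' : (1 : ℝ) ≤ B := by exact_mod_cast hA.trans hB
    rw [Finset.sum_Ico_succ_top (by omega)]
    have h1 := Real.log_le_sub_one_of_pos (x := ((B + 1 : ℕ) : ℝ) / B) (by positivity)
    have h2 : Real.log ((B + 1 : ℕ) / A) = Real.log (B / A) + Real.log (((B + 1 : ℕ) : ℝ) / B) := by
      rw [← Real.log_mul (by positivity) (by positivity)]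
      congr 1; field_simp
    have h3 : ((B + 1 : ℕ) : ℝ) / B - 1 = 1 / (B : ℝ) := by
      push_cast; field_simp; ring
    linarith

theorem log_half_add_one_ge {b : ℕ} (hb : 1 ≤ b) : 1 / 3 ≤ Real.log (((b : ℝ) + 2) / 2) := by
  have hb' : (1 : ℝ) ≤ b := by exact_mod_cast hb
  have h1 := Real.one_sub_inv_le_log_of_pos (x := 3 / 2) (by norm_num)
  have h2 : Real.log (3 / 2) ≤ Real.log (((b : ℝ) + 2) / 2) :=
    Real.log_le_log (by norm_num) (by linarith)
  norm_num at h1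
  linarith

/-- Split at `√X`: below it each term is at most `3`; above it the logarithm is at least `log X /
4`. -/
theorem sum_inv_log_le {X : ℝ} (hX : 1 < X) :
    ∑ b ∈ Finset.Icc 1 ⌊X⌋₊, 1 / Real.log (((b : ℝ) + 2) / 2) ≤
      3 * √X + 4 * X / Real.log X := by
  have hlX : 0 < Real.log X := Real.log_pos hX
  have hpt : ∀ b ∈ Finset.Icc 1 ⌊X⌋₊, 1 / Real.log (((b : ℝ) + 2) / 2) ≤
      (if b ≤ ⌊√X⌋₊ then 3 else 0) + 4 / Real.log X := by
    intro b hb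
    have hb1 : 1 ≤ b := (Finset.mem_Icc.1 hb).1
    have h3 := log_half_add_one_ge hb1
    split_ifs with h
    · have e1 : 1 / Real.log (((b : ℝ) + 2) / 2) ≤ 3 := by
        rw [div_le_iff₀ (by linarith)]; linarith
      have e2 : 0 < 4 / Real.log X := by positivity
      linarith
    · have hbX : √X < b := (Nat.floor_lt (Real.sqrt_nonneg X)).1 (not_le.1 h)
      have hb' : (0 : ℝ) < b := by exact_mod_cast hb1
      have e1 := half_log_le_log_half_add_one hb'
      have e2 : Real.log (√X) ≤ Real.log b := Real.log_le_log (Real.sqrt_pos.2 (by linarith)) hbX.le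
      rw [Real.log_sqrt (by linarith)] at e2
      rw [zero_add, div_le_div_iff₀ (by linarith) hlX]
      linarith
  refine (Finset.sum_le_sum hpt).trans ?_
  rw [Finset.sum_add_distrib, ← Finset.sum_filter, Finset.sum_const, Finset.sum_const,
    nsmul_eq_mul, nsmul_eq_mul, Nat.card_Icc, add_tsub_cancel_right]
  have hc : (((Finset.Icc 1 ⌊X⌋₊).filter fun b => b ≤ ⌊√X⌋₊).card : ℝ) ≤ √X := by
    refine le_trans ?_ (Nat.floor_le (Real.sqrt_nonneg X))
    have : ((Finset.Icc 1 ⌊X⌋₊).filter fun b => b ≤ ⌊√X⌋₊) ⊆ Finset.Icc 1 ⌊√X⌋₊ := fun b hb => by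
      rw [Finset.mem_filter, Finset.mem_Icc] at hb
      exact Finset.mem_Icc.2 ⟨hb.1.1, hb.2⟩
    exact_mod_cast (Finset.card_le_card this).trans_eq (by simp)
  have hf : (⌊X⌋₊ : ℝ) ≤ X := Nat.floor_le (by linarith)
  have : (⌊X⌋₊ : ℝ) * (4 / Real.log X) ≤ X * (4 / Real.log X) := by gcongr
  have e : X * (4 / Real.log X) = 4 * X / Real.log X := by ring
  linarith

/-- At the crossing point `X = Z (1 + log Z)` one has `√X ≤ Z` and `X / log X ≤ 2 Z`, so the bound
is `3 Z + 4 · 2 Z`. -/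
theorem sum_inv_log_le_of_eq {Z : ℝ} (hZ : 2 ≤ Z) :
    ∑ b ∈ Finset.Icc 1 ⌊Z * (1 + Real.log Z)⌋₊, 1 / Real.log (((b : ℝ) + 2) / 2) ≤ 11 * Z := by
  have hl2 : 0.6931471803 < Real.log Z :=
    Real.log_two_gt_d9.trans_le (Real.log_le_log (by norm_num) hZ)
  set X := Z * (1 + Real.log Z) with hX
  have hX3 : 3.3 ≤ X := by nlinarith
  refine (sum_inv_log_le (by linarith : 1 < X)).trans ?_
  have hlogZ : Real.log Z ≤ Z - 1 := Real.log_le_sub_one_of_pos (by linarith)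
  have h1 : √X ≤ Z := by
    rw [Real.sqrt_le_left (by linarith)]; nlinarith
  have hlX1 : 1 ≤ Real.log X := by
    rw [Real.le_log_iff_exp_le (by linarith)]
    linarith [Real.exp_one_lt_d9]
  have hlX2 : Real.log Z ≤ Real.log X := Real.log_le_log (by linarith) (by nlinarith)
  have h2 : X / Real.log X ≤ 2 * Z := by
    rw [div_le_iff₀ (by linarith), hX]
    nlinarith
  have e : 4 * X / Real.log X = 4 * (X / Real.log X) := by ring
  linarith

/-! ### Times with a large value of `phi` -/

namespace IsDenomSeq

variable {α : ℝ} {q : ℕ → ℕ}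

theorem norm_lt_of_large_phi (H : IsDenomSeq α q) {n N : ℕ} (hQ : 1 < q n) (hN : q n ≤ N)
    {x : UnitAddCircle} (hx : ∀ k, x + orbitPoint α k ≠ 0) {ε : ℝ} (hε : 0 < ε)
    (hbad : ε * ∑ k ∈ Finset.range N, phi (x + orbitPoint α k) < phi (x + orbitPoint α N)) :
    ‖x + orbitPoint α N‖ ≤ 8 / (ε * Real.log (q n)) * (1 / N) := by
  have hlog : 0 < Real.log (q n) := Real.log_pos (by exact_mod_cast hQ)
  have hN0 : (0 : ℝ) < N := by exact_mod_cast (zero_lt_one.trans hQ).trans_le hN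
  have hpos : 0 < ‖x + orbitPoint α N‖ := norm_pos_iff.2 (hx N)
  have h1 := H.birkhoff_lower_bound n hN hx
  have h2 : ε * (N * Real.log (q n) / 4) < 2 / ‖x + orbitPoint α N‖ :=
    (mul_le_mul_of_nonneg_left h1 hε.le).trans_lt (hbad.trans_le (phi_le_two_div_norm (hx N)))
  rw [lt_div_iff₀ hpos] at h2
  rw [div_mul_div_comm, le_div_iff₀ (by positivity)]
  linarith

theorem norm_orbitPoint_mul_le (H : IsDenomSeq α q) (n j : ℕ) :
    ‖orbitPoint α (j * q n)‖ ≤ j / q (n + 1) := by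
  obtain ⟨p, -, hp⟩ := H.exists_approx n
  have e : orbitPoint α (j * q n) = ((j * (q n * α - p) : ℝ) : UnitAddCircle) := by
    rw [orbitPoint, ← sub_eq_zero, ← AddCircle.coe_sub, AddCircle.coe_eq_zero_iff]
    exact ⟨j * p, by push_cast; rw [zsmul_eq_mul]; push_cast; ring⟩
  rw [e]
  refine (UnitAddCircle.norm_coe_le_abs _).trans ?_
  rw [abs_mul, Nat.abs_cast, div_eq_mul_one_div]
  gcongr

/-- Only the returns at times `N - (j + 1) q_n` are counted; their points lie within `y + (j +
1)/Q'` of the origin. If `y ≥ 1/Q'`, they already contribute `l / y`, too much since `ε l ≥ 2`.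
Hence `y < 1/Q'`, and then they contribute at least `Q' l`. -/
theorem norm_lt_of_large_phi_of_le_div (H : IsDenomSeq α q) {n N : ℕ}
    {x : UnitAddCircle} (hx : ∀ k, x + orbitPoint α k ≠ 0) {ε : ℝ} (hε : 0 < ε)
    (hb : 2 / ε ≤ Real.log (((N / q n : ℕ) + 2) / 2))
    (hbad : ε * ∑ k ∈ Finset.range N, phi (x + orbitPoint α k) < phi (x + orbitPoint α N)) :
    ‖x + orbitPoint α N‖ ≤ 2 / (ε * q (n + 1)) * (1 / Real.log (((N / q n : ℕ) + 2) / 2)) := by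
  set b := N / q n with hbdef
  set l := Real.log (((b : ℝ) + 2) / 2) with hl
  set Q' : ℝ := (q (n + 1) : ℝ) with hQ'
  have hQ'1 : 1 ≤ Q' := H.one_le_cast _
  have hQpos : 0 < q n := H.pos n
  set y := ‖x + orbitPoint α N‖ with hy
  have hpos : 0 < y := norm_pos_iff.2 (hx N)
  have hl0 : 0 < l := (by positivity : 0 < 2 / ε).trans_le hb
  have hbN : b * q n ≤ N := Nat.div_mul_le_self _ _
  have hle : ∀ j ∈ Finset.range b, (j + 1) * q n ≤ N := fun j hj =>
    (Nat.mul_le_mul_right _ (Finset.mem_range.1 hj)).trans hbN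
  -- the visits at times `N - (j + 1) q_n`
  have hS : ∑ j ∈ Finset.range b, 1 / (y + (j + 1) / Q') ≤
      ∑ k ∈ Finset.range N, phi (x + orbitPoint α k) := by
    have hinj : Set.InjOn (fun j => N - (j + 1) * q n) (Finset.range b) := by
      intro i hi j hj hij
      have h1 := hle i hi
      have h2 := hle j hj
      have h3 : (i + 1) * q n = (j + 1) * q n := by simp only at hij; omega
      have := Nat.eq_of_mul_eq_mul_right hQpos h3
      omega
    calc ∑ j ∈ Finset.range b, 1 / (y + (j + 1) / Q')
        ≤ ∑ j ∈ Finset.range b, phi (x + orbitPoint α (N - (j + 1) * q n)) := by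
          refine Finset.sum_le_sum fun j hj => le_trans ?_ (inv_norm_le_phi (hx _))
          refine one_div_le_one_div_of_le (norm_pos_iff.2 (hx _)) ?_
          have e : x + orbitPoint α (N - (j + 1) * q n) =
              (x + orbitPoint α N) - orbitPoint α ((j + 1) * q n) := by
            have := orbitPoint_add α (N - (j + 1) * q n) ((j + 1) * q n)
            rw [Nat.sub_add_cancel (hle j hj)] at this
            rw [this]; abel
          rw [e]
          refine (norm_sub_le _ _).trans ?_
          gcongr
          have := H.norm_orbitPoint_mul_le n (j + 1)
          push_cast at this
          exact this
      _ = ∑ k ∈ (Finset.range b).image (fun j => N - (j + 1) * q n), phi (x + orbitPoint α k) := by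
          rw [Finset.sum_image hinj]
      _ ≤ _ := by
          refine Finset.sum_le_sum_of_subset_of_nonneg ?_
            fun _ _ _ => zero_le_one.trans (one_le_phi _)
          intro k hk
          obtain ⟨j, hj, rfl⟩ := Finset.mem_image.1 hk
          have := hle j hj
          have : 0 < (j + 1) * q n := by positivity
          exact Finset.mem_range.2 (by omega)
  have hsum : l ≤ ∑ j ∈ Finset.range b, 1 / ((j : ℝ) + 2) := log_half_add_one_le_sum b
  have hfin : ε * ∑ j ∈ Finset.range b, 1 / (y + (j + 1) / Q') < 2 / y :=
    (mul_le_mul_of_nonneg_left hS hε.le).trans_lt (hbad.trans_le (phi_le_two_div_norm (hx N)))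
  -- Used twice, with `c = y` to exclude large `y` and with `c = 1 / Q'` for the final estimate.
  have hbound : ∀ c : ℝ, 0 < c → (∀ j : ℕ, y + (j + 1) / Q' ≤ c * (j + 2)) →
      ε * (l / c) < 2 / y := by
    intro c hc hcj
    refine lt_of_le_of_lt ?_ hfin
    gcongr
    calc l / c ≤ (∑ j ∈ Finset.range b, 1 / ((j : ℝ) + 2)) / c := by gcongr
      _ = ∑ j ∈ Finset.range b, 1 / (c * ((j : ℝ) + 2)) := by
        rw [Finset.sum_div]
        refine Finset.sum_congr rfl fun j _ => ?_
        rw [div_div, mul_comm]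
      _ ≤ _ := by
        refine Finset.sum_le_sum fun j _ => ?_
        exact one_div_le_one_div_of_le (by positivity) (hcj j)
  have hy1 : y < 1 / Q' := by
    by_contra hcon
    push Not at hcon
    have := hbound y hpos fun j => by
      have : ((j : ℝ) + 1) / Q' ≤ (j + 1) * y := by
        rw [div_eq_mul_one_div]; gcongr
      linarith
    rw [mul_div_assoc', div_lt_div_iff_of_pos_right hpos] at this
    rw [div_le_iff₀ hε] at hb
    linarith
  have := hbound (1 / Q') (by positivity) fun j => by
    have : ((j : ℝ) + 1) / Q' = (1 / Q') * (j + 1) := by ring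
    rw [this]; linarith
  rw [lt_div_iff₀ hpos] at this
  rw [div_mul_div_comm, mul_one, le_div_iff₀ (by positivity)]
  have e : ε * (l / (1 / Q')) * y = y * (ε * Q' * l) := by field_simp
  linarith

end IsDenomSeq

/-! ### Sums of radii -/

/-- The weight of the times `N ≥ X Q` below `Q'`, where `X = Z (1 + log Z)`. -/
theorem sum_filter_inv_le {Q Q' : ℕ} {L Z : ℝ} (hQ : 1 ≤ Q) (hL : 0 < L) (hZ : 2 ≤ Z)
    (hZL : Z * Q * L = Q') :
    ∑ N ∈ (Finset.Ico Q Q').filter (fun N : ℕ => Z * (1 + Real.log Z) * Q ≤ N), (1 : ℝ) / N ≤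
      1 / Q + max 1 (Real.log L - Real.log (Real.log Z)) := by
  have hQ' : (1 : ℝ) ≤ Q := by exact_mod_cast hQ
  have hlZ : 0 < Real.log Z := Real.log_pos (by linarith)
  set X := Z * (1 + Real.log Z) with hX
  have hX1 : 1 ≤ X := by nlinarith
  set A := ⌈X * Q⌉₊ with hA
  have hAX : X * Q ≤ A := Nat.le_ceil _
  have hQA : (Q : ℝ) ≤ A := by nlinarith
  have hA1 : 1 ≤ A := by exact_mod_cast hQ'.trans hQA
  have hsub : (Finset.Ico Q Q').filter (fun N : ℕ => X * Q ≤ N) ⊆ Finset.Ico A Q' := fun N hN => by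
    rw [Finset.mem_filter, Finset.mem_Ico] at hN
    exact Finset.mem_Ico.2 ⟨Nat.ceil_le.2 hN.2, hN.1.2⟩
  refine (Finset.sum_le_sum_of_subset_of_nonneg hsub fun _ _ _ => by positivity).trans ?_
  rcases le_or_gt A Q' with h | h
  · refine (sum_Ico_inv_le hA1 h).trans (add_le_add (one_div_le_one_div_of_le (by linarith) hQA) ?_)
    refine le_trans ?_ (le_max_right _ _)
    have hQ'pos : (0 : ℝ) < Q' := by exact_mod_cast (hA1.trans h)
    have hA0 : (0 : ℝ) < A := by linarith
    rw [← Real.log_div hL.ne' hlZ.ne']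
    -- As `Z Q L = Q'` and `A ≥ X Q`, the ratio `Q' / A` is at most `L / (1 + log Z)`.
    refine Real.log_le_log (by positivity) ?_
    rw [div_le_div_iff₀ hA0 hlZ, ← hZL]
    calc Z * Q * L * Real.log Z ≤ L * (X * Q) := by
          rw [hX]; nlinarith [mul_pos (mul_pos (by linarith : 0 < Z) (by linarith : (0 : ℝ) < Q)) hL]
      _ ≤ L * A := by gcongr
  · rw [Finset.Ico_eq_empty (by omega), Finset.sum_empty]
    have := le_max_left (1 : ℝ) (Real.log L - Real.log (Real.log Z))
    have : (0 : ℝ) ≤ 1 / Q := by positivity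
    linarith

/-- At most `Q` times share a given quotient `N / Q`. -/
theorem sum_filter_inv_log_div_le {Q Q' : ℕ} {Z : ℝ} (hQ : 1 ≤ Q) (hZ : 2 ≤ Z) :
    ∑ N ∈ (Finset.Ico Q Q').filter (fun N : ℕ => (N : ℝ) < Z * (1 + Real.log Z) * Q),
      1 / Real.log (((N / Q : ℕ) + 2) / 2) ≤ Q * (11 * Z) := by
  have hQ' : (1 : ℝ) ≤ Q := by exact_mod_cast hQ
  set X := Z * (1 + Real.log Z) with hX
  set F := (Finset.Ico Q Q').filter (fun N : ℕ => (N : ℝ) < X * Q) with hF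
  have hmaps : ∀ N ∈ F, N / Q ∈ Finset.Icc 1 ⌊X⌋₊ := fun N hN => by
    rw [hF, Finset.mem_filter, Finset.mem_Ico] at hN
    refine Finset.mem_Icc.2 ⟨Nat.div_pos hN.1.1 hQ, Nat.le_floor ?_⟩
    refine (Nat.cast_div_le (α := ℝ)).trans ?_
    rw [div_le_iff₀ (by linarith)]
    exact hN.2.le
  rw [← Finset.sum_fiberwise_of_maps_to hmaps]
  refine le_trans ?_ (mul_le_mul_of_nonneg_left (sum_inv_log_le_of_eq hZ) (by linarith : (0 : ℝ) ≤ Q))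
  rw [Finset.mul_sum]
  refine Finset.sum_le_sum fun b hb => ?_
  have hb0 := log_half_add_one_ge (Finset.mem_Icc.1 hb).1
  have e : ∑ N ∈ F.filter (fun N => N / Q = b), 1 / Real.log (((N / Q : ℕ) + 2) / 2) =
      ∑ N ∈ F.filter (fun N => N / Q = b), 1 / Real.log (((b : ℝ) + 2) / 2) :=
    Finset.sum_congr rfl fun N hN => by rw [(Finset.mem_filter.1 hN).2]
  rw [e, Finset.sum_const, nsmul_eq_mul]
  have hcard : (F.filter (fun N => N / Q = b)).card ≤ Q := by
    refine (Finset.card_le_card_of_injOn (t := Finset.range Q) (fun k => k % Q) ?_ ?_).trans_eq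
      (Finset.card_range Q)
    · intro k _
      exact Finset.mem_coe.2 (Finset.mem_range.2 (Nat.mod_lt _ hQ))
    · intro j hj k hk hjk
      have h1 := (Finset.mem_filter.1 hj).2
      have h2 := (Finset.mem_filter.1 hk).2
      have e1 := Nat.div_add_mod j Q
      have e2 := Nat.div_add_mod k Q
      simp only at hjk
      rw [h1, hjk] at e1
      rw [h2] at e2
      omega
  have : (0 : ℝ) ≤ 1 / Real.log (((b : ℝ) + 2) / 2) := by
    have : 0 < Real.log (((b : ℝ) + 2) / 2) := by linarith
    positivity
  gcongr

/-! ### Convergent case: exceptional sets and Borel–Cantelli -/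

namespace IsDenomSeq

variable {α : ℝ} {q : ℕ → ℕ}

/-- The points for which `phi` exceeds `ε` times the preceding Birkhoff sum at some time
between `q n` and `q (n + 1)`. -/
def largeSet (α : ℝ) (q : ℕ → ℕ) (ε : ℝ) (n : ℕ) : Set UnitAddCircle :=
  {x | (∀ k, x + orbitPoint α k ≠ 0) ∧ ∃ N ∈ Finset.Ico (q n) (q (n + 1)),
    ε * ∑ k ∈ Finset.range N, phi (x + orbitPoint α k) < phi (x + orbitPoint α N)}

theorem volume_largeSet_le_of_radius {ε : ℝ} {n : ℕ} {r : ℕ → ℝ}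
    (hr0 : ∀ N ∈ Finset.Ico (q n) (q (n + 1)), 0 ≤ r N)
    (hr : ∀ N ∈ Finset.Ico (q n) (q (n + 1)), ∀ x, (∀ k, x + orbitPoint α k ≠ 0) →
      ε * ∑ k ∈ Finset.range N, phi (x + orbitPoint α k) < phi (x + orbitPoint α N) →
      ‖x + orbitPoint α N‖ ≤ r N) :
    volume (largeSet α q ε n) ≤ ENNReal.ofReal (2 * ∑ N ∈ Finset.Ico (q n) (q (n + 1)), r N) := by
  have hsub : largeSet α q ε n ⊆
      ⋃ N ∈ Finset.Ico (q n) (q (n + 1)), {x | ‖x + orbitPoint α N‖ ≤ r N} := by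
    rintro x ⟨hx, N, hN, hbad⟩
    exact Set.mem_biUnion hN (hr N hN x hx hbad)
  refine (measure_mono hsub).trans ((measure_biUnion_finset_le _ _).trans ?_)
  rw [Finset.mul_sum, ENNReal.ofReal_sum_of_nonneg fun N hN => by linarith [hr0 N hN]]
  exact Finset.sum_le_sum fun N _ => volume_norm_add_le _ le_rfl

/-- If `Q' < 2 Q L`, the radius `8/(ε L N)` is used throughout. Otherwise it serves for `N < b₀ Q`
and for `N ≥ X Q`, and the radius from close returns serves in between. The first and middle ranges
cost `O(1/L)`, which the maximum with `1` in `W` absorbs. -/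
theorem volume_largeSet_le (H : IsDenomSeq α q) (hq : ∀ n, cfDen α n = q n) {ε : ℝ} (hε : 0 < ε) :
    ∃ K : ℝ, 0 ≤ K ∧ ∀ n, 3 ≤ q n → 0 ≤ W α n ∧
      volume (largeSet α q ε n) ≤ ENNReal.ofReal (K * (W α n + 1 / q n)) := by
  -- Chosen so that `log ((b + 2)/2) ≥ 2/ε` for `b ≥ b₀`, as the bound from close returns requires.
  set b₀ : ℕ := ⌈2 * Real.exp (2 / ε)⌉₊ + 1 with hb₀
  have hb₀1 : (1 : ℝ) ≤ b₀ := by rw [hb₀]; push_cast; linarith [Nat.cast_nonneg (α := ℝ) ⌈2 * Real.exp (2 / ε)⌉₊]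
  have hlb₀ : 0 ≤ Real.log b₀ := Real.log_nonneg hb₀1
  refine ⟨2 / ε * (46 + 8 * Real.log b₀), by positivity, fun n hn => ?_⟩
  have hQ3 : (3 : ℝ) ≤ q n := by exact_mod_cast hn
  have hQ1 : 1 < q n := by omega
  set Q := q n with hQ
  set Q' := q (n + 1) with hQ'
  have hQQ' : (Q : ℝ) ≤ Q' := H.cast_mono n.le_succ
  set L := Real.log Q with hL
  have hL1 : 1 ≤ L := by
    rw [hL, Real.le_log_iff_exp_le (by linarith)]; linarith [Real.exp_one_lt_d9]
  have hQinv : (0 : ℝ) < 1 / Q := by positivity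
  rw [W, hq, hq]
  split_ifs with hcase
  · rw [← Real.log_div (by linarith) (by linarith)]
    have hlog : 0 ≤ Real.log (Q' / Q) := Real.log_nonneg (by rw [le_div_iff₀ (by linarith)]; linarith)
    refine ⟨by positivity, ?_⟩
    refine (volume_largeSet_le_of_radius (r := fun N => 8 / (ε * L) * (1 / N))
      (fun N _ => by positivity)
      (fun N hN x hx hbad => H.norm_lt_of_large_phi hQ1 (Finset.mem_Ico.1 hN).1 hx hε hbad)).trans ?_
    refine ENNReal.ofReal_le_ofReal ?_
    rw [← Finset.mul_sum]
    have h1 := sum_Ico_inv_le (A := Q) (B := Q') (by omega) (H.mono' n)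
    calc 2 * (8 / (ε * L) * ∑ N ∈ Finset.Ico Q Q', (1 : ℝ) / N)
        ≤ 2 * (8 / (ε * L) * (1 / Q + Real.log (Q' / Q))) := by gcongr
      _ = 2 / ε * 8 * (Real.log (Q' / Q) / L + 1 / Q / L) := by field_simp; ring
      _ ≤ 2 / ε * (46 + 8 * Real.log b₀) * (Real.log (Q' / Q) / L + 1 / Q) := by
        refine mul_le_mul ?_ (add_le_add le_rfl (div_le_self hQinv.le hL1)) (by positivity)
          (by positivity)
        gcongr
        linarith
  · push Not at hcase
    set Z : ℝ := Q' / (Q * L) with hZ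
    have hQL : 0 < Q * L := by positivity
    have hZ2 : 2 ≤ Z := by rw [hZ, le_div_iff₀ hQL]; linarith
    have hZL : Z * Q * L = Q' := by rw [hZ]; field_simp
    set D := max 1 (Real.log L - Real.log (Real.log Z)) with hD
    have hD1 : 1 ≤ D := le_max_left _ _
    refine ⟨by positivity, ?_⟩
    set X := Z * (1 + Real.log Z) with hX
    set far : ℕ → ℝ := fun N => 8 / (ε * L) * (1 / N) with hfar
    set mid : ℕ → ℝ := fun N => 2 / (ε * Q') * (1 / Real.log (((N / Q : ℕ) + 2) / 2)) with hmid
    have hfar0 : ∀ N, 0 ≤ far N := fun N => by simp only [hfar]; positivity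
    have hmid0 : ∀ N ∈ Finset.Ico Q Q', 0 ≤ mid N := fun N hN => by
      have := log_half_add_one_ge (Nat.div_pos (Finset.mem_Ico.1 hN).1 (by omega : 0 < Q))
      have : 0 < Real.log (((N / Q : ℕ) + 2) / 2) := by linarith
      simp only [hmid]; positivity
    -- Adding the pieces instead of choosing among them is harmless: they are nonnegative and one of
    -- them is a valid radius at each `N`.
    set r : ℕ → ℝ := fun N => (if N < b₀ * Q then far N else 0) +
      ((if (N : ℝ) < X * Q then mid N else 0) + (if X * Q ≤ N then far N else 0)) with hr
    have hr0 : ∀ N ∈ Finset.Ico Q Q', 0 ≤ r N := fun N hN => by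
      have h1 := hfar0 N
      have h2 := hmid0 N hN
      simp only [hr]
      split_ifs <;> linarith
    refine (volume_largeSet_le_of_radius hr0 fun N hN x hx hbad => ?_).trans ?_
    · have hf : ‖x + orbitPoint α N‖ ≤ far N :=
        H.norm_lt_of_large_phi hQ1 (Finset.mem_Ico.1 hN).1 hx hε hbad
      have h1 := hfar0 N
      have h2 := hmid0 N hN
      by_cases hA : N < b₀ * Q
      · simp only [hr, if_pos hA]
        split_ifs <;> linarith
      by_cases hB : X * Q ≤ N
      · simp only [hr, if_pos hB]
        split_ifs <;> linarith
      have hm : ‖x + orbitPoint α N‖ ≤ mid N := by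
        refine H.norm_lt_of_large_phi_of_le_div hx hε ?_ hbad
        have h3 : b₀ ≤ N / Q := (Nat.le_div_iff_mul_le (by omega)).2 (not_lt.1 hA)
        have h4 : (b₀ : ℝ) ≤ (N / Q : ℕ) := by exact_mod_cast h3
        have h5 : 2 * Real.exp (2 / ε) ≤ b₀ := by
          rw [hb₀]; push_cast; linarith [Nat.le_ceil (2 * Real.exp (2 / ε))]
        rw [Real.le_log_iff_exp_le (by positivity)]
        linarith
      simp only [hr, if_neg hA, if_neg hB, if_pos (not_le.1 hB)]
      linarith
    refine ENNReal.ofReal_le_ofReal ?_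
    have hS1 : ∑ N ∈ Finset.Ico Q Q', (if N < b₀ * Q then far N else 0) ≤
        8 / (ε * L) * (1 / Q + Real.log b₀) := by
      rw [← Finset.sum_filter]
      simp only [hfar]
      rw [← Finset.mul_sum]
      gcongr
      have hb₀' : 1 ≤ b₀ := by exact_mod_cast hb₀1
      have h1 := sum_Ico_inv_le (A := Q) (B := b₀ * Q) (by omega) (Nat.le_mul_of_pos_left _ hb₀')
      have e : ((b₀ * Q : ℕ) : ℝ) / Q = b₀ := by push_cast; field_simp
      rw [e] at h1
      refine le_trans (Finset.sum_le_sum_of_subset_of_nonneg ?_ fun _ _ _ => by positivity) h1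
      intro N hN
      rw [Finset.mem_filter, Finset.mem_Ico] at hN
      exact Finset.mem_Ico.2 ⟨hN.1.1, hN.2⟩
    have hS2 : ∑ N ∈ Finset.Ico Q Q', (if (N : ℝ) < X * Q then mid N else 0) ≤ 22 / (ε * L) := by
      rw [← Finset.sum_filter]
      simp only [hmid]
      rw [← Finset.mul_sum]
      have h1 := sum_filter_inv_log_div_le (Q := Q) (Q' := Q') (by omega) hZ2
      have hQ'0 : (0 : ℝ) < Q' := by linarith
      calc _ ≤ 2 / (ε * Q') * (Q * (11 * Z)) := by gcongr
        _ = 22 / (ε * L) := by rw [← hZL]; field_simp; norm_num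
    have hS3 : ∑ N ∈ Finset.Ico Q Q', (if X * Q ≤ N then far N else 0) ≤
        8 / (ε * L) * (1 / Q + D) := by
      rw [← Finset.sum_filter]
      simp only [hfar]
      rw [← Finset.mul_sum]
      gcongr
      exact sum_filter_inv_le (by omega) (by linarith) hZ2 hZL
    simp only [hr]
    rw [Finset.sum_add_distrib, Finset.sum_add_distrib]
    have hiL : 1 / L ≤ D / L := by gcongr
    have hQL' : 1 / Q / L ≤ 1 / Q := div_le_self hQinv.le hL1
    have hεinv : 0 < 1 / ε := by positivity
    calc _ ≤ 2 * (8 / (ε * L) * (1 / Q + Real.log b₀) + (22 / (ε * L) + 8 / (ε * L) * (1 / Q + D))) := by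
          gcongr
      _ = 2 / ε * (16 * (1 / Q / L) + (8 * Real.log b₀ + 22) * (1 / L) + 8 * (D / L)) := by
          field_simp; ring
      _ ≤ 2 / ε * (16 * (1 / Q) + (8 * Real.log b₀ + 22) * (D / L) + 8 * (D / L)) := by
          gcongr
      _ ≤ 2 / ε * (46 + 8 * Real.log b₀) * (D / L + 1 / Q) := by
          rw [mul_assoc]
          gcongr
          have : 0 ≤ D / L := by positivity
          nlinarith

theorem exists_three_le (H : IsDenomSeq α q) : ∃ n₀, 2 ≤ n₀ ∧ ∀ n, n₀ ≤ n → 3 ≤ q n := by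
  have h0 := H.pos 0
  have h1 := H.pos 1
  have h2 := H.add_le 0
  have h3 := H.add_le 1
  simp only [Nat.reduceAdd] at h2 h3
  refine ⟨3, by norm_num, fun n hn => ?_⟩
  have := H.monotone hn
  omega

theorem self_le (H : IsDenomSeq α q) (n : ℕ) : n ≤ q n := by
  induction n using Nat.strong_induction_on with
  | _ n ih =>
    match n with
    | 0 => omega
    | 1 => exact H.pos 1
    | n + 2 =>
      have := ih (n + 1) (by omega)
      have := H.add_le n
      have := H.pos n
      omega

theorem exists_mem_Ico (H : IsDenomSeq α q) {n₀ N : ℕ} (hN : q n₀ ≤ N) :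
    ∃ n, n₀ ≤ n ∧ N ∈ Finset.Ico (q n) (q (n + 1)) := by
  have hex : ∃ m, N < q m := ⟨N + 1, H.self_le (N + 1)⟩
  classical
  set m := Nat.find hex with hm
  have h1 : N < q m := Nat.find_spec hex
  have h2 : n₀ < m := by
    by_contra h
    have := H.monotone (not_lt.1 h)
    omega
  obtain ⟨k, hk⟩ : ∃ k, m = k + 1 := ⟨m - 1, by omega⟩
  refine ⟨k, by omega, Finset.mem_Ico.2 ⟨?_, hk ▸ h1⟩⟩
  by_contra h
  have := Nat.find_min hex (m := k) (by omega)
  omega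

theorem two_mul_le (H : IsDenomSeq α q) (n : ℕ) : 2 * q n ≤ q (n + 2) := by
  have := H.add_le n
  have := H.mono' n
  omega

theorem sum_range_le (H : IsDenomSeq α q) (n : ℕ) : ∑ m ∈ Finset.range n, q m ≤ q (n + 1) := by
  induction n with
  | zero => simp
  | succ n ih =>
    rw [Finset.sum_range_succ]
    have := H.add_le n
    linarith

theorem sum_range_succ_le (H : IsDenomSeq α q) (n : ℕ) :
    ∑ m ∈ Finset.range (n + 1), q m ≤ 3 * q n := by
  cases n with
  | zero => rw [Finset.sum_range_one]; omega
  | succ n =>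
    rw [Finset.sum_range_succ, Finset.sum_range_succ]
    have := H.sum_range_le n
    have := H.mono' n
    omega

/-- Denominators at least double every two steps, so `1 / q n` decays like `2 ^ (-n / 2)`. -/
theorem summable_one_div (H : IsDenomSeq α q) : Summable fun n => (1 : ℝ) / q n := by
  have hle : ∀ n, (1 : ℝ) / q n ≤ 2 * (1 / √2) ^ n := by
    intro n
    induction n using Nat.strong_induction_on with
    | _ n ih =>
      match n with
      | 0 =>
        have := H.one_le_cast 0
        have h1 : (1 : ℝ) / q 0 ≤ 1 := by rw [div_le_one (by linarith)]; exact this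
        simp only [pow_zero]; linarith
      | 1 =>
        have := H.one_le_cast 1
        have h1 : (1 : ℝ) / q 1 ≤ 1 := by rw [div_le_one (by linarith)]; exact this
        have h2 : √2 ≤ 2 := by rw [Real.sqrt_le_left (by norm_num)]; norm_num
        have h3 : 1 ≤ 2 * (1 / √2) ^ 1 := by
          rw [pow_one, mul_one_div, le_div_iff₀ (by positivity)]; linarith
        linarith
      | n + 2 =>
        have h := ih n (by omega)
        have h1 : (2 * q n : ℝ) ≤ q (n + 2) := by exact_mod_cast H.two_mul_le n
        have h2 := H.one_le_cast n
        have h3 : (1 / √2) ^ 2 = (1 / 2 : ℝ) := by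
          rw [div_pow, Real.sq_sqrt (by norm_num), one_pow]
        calc (1 : ℝ) / q (n + 2) ≤ 1 / (2 * q n) :=
              one_div_le_one_div_of_le (by linarith) h1
          _ = 1 / q n * (1 / 2) := by field_simp
          _ ≤ 2 * (1 / √2) ^ n * (1 / 2) := by gcongr
          _ = 2 * (1 / √2) ^ (n + 2) := by rw [pow_add, h3]; ring
  refine Summable.of_nonneg_of_le (fun n => by positivity) hle ?_
  refine (summable_geometric_of_lt_one (by positivity) ?_).mul_left 2
  rw [div_lt_one (by positivity)]
  exact Real.lt_sqrt_of_sq_lt (by norm_num)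

/-- First Borel–Cantelli lemma for the sets `largeSet`. Every large `N` lies in some block `[q n, q
(n + 1))`, so avoiding all late sets controls all late times. -/
theorem ae_eventually_phi_le (H : IsDenomSeq α q) (hq : ∀ n, cfDen α n = q n)
    (hsum : Summable fun n : ℕ => W α (n + 1)) {ε : ℝ} (hε : 0 < ε) :
    ∀ᵐ x : UnitAddCircle, ∀ᶠ N in atTop,
      phi (x + orbitPoint α N) ≤ ε * ∑ k ∈ Finset.range N, phi (x + orbitPoint α k) := by
  obtain ⟨K, hK0, hK⟩ := H.volume_largeSet_le hq hε
  obtain ⟨n₀, hn₀1, hn₀⟩ := H.exists_three_le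
  have hsum' : Summable fun n : ℕ => K * (W α (n + n₀) + 1 / q (n + n₀)) := by
    refine Summable.mul_left K (Summable.add ?_ ?_)
    · have h1 := (summable_nat_add_iff (n₀ - 1)).2 hsum
      refine h1.congr fun n => ?_
      congr 1; omega
    · exact (summable_nat_add_iff n₀).2 H.summable_one_div
  have hnn : ∀ n, 0 ≤ K * (W α (n + n₀) + 1 / q (n + n₀)) := fun n => by
    have h1 := (hK (n + n₀) (hn₀ _ (by omega))).1
    positivity
  have hfin : ∑' n, volume (largeSet α q ε (n + n₀)) ≠ ⊤ := by
    refine ne_top_of_le_ne_top hsum'.tsum_ofReal_ne_top (ENNReal.tsum_le_tsum fun n => ?_)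
    exact (hK (n + n₀) (hn₀ _ (by omega))).2
  filter_upwards [ae_eventually_notMem hfin, ae_add_orbitPoint_ne_zero α] with x hx hgen
  obtain ⟨n₁, hn₁⟩ := eventually_atTop.1 hx
  filter_upwards [eventually_ge_atTop (q (n₁ + n₀))] with N hN
  obtain ⟨n, hn, hNn⟩ := H.exists_mem_Ico hN
  have h := hn₁ (n - n₀) (by omega)
  rw [Nat.sub_add_cancel (by omega)] at h
  by_contra hcon
  exact h ⟨hgen, N, hNn, not_le.1 hcon⟩

theorem ae_extravagance_eq_zero (H : IsDenomSeq α q) (hq : ∀ n, cfDen α n = q n)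
    (hsum : Summable fun n : ℕ => W α (n + 1)) :
    ∀ᵐ x : UnitAddCircle, extravagance α x = 0 := by
  have h : ∀ᵐ x : UnitAddCircle, ∀ m : ℕ, ∀ᶠ N in atTop, phi (x + orbitPoint α N) ≤
      1 / ((m : ℝ) + 1) * ∑ k ∈ Finset.range N, phi (x + orbitPoint α k) :=
    ae_all_iff.2 fun m => H.ae_eventually_phi_le hq hsum (by positivity)
  filter_upwards [h] with x hx
  have hlim : Tendsto (fun N : ℕ => phi ((torusRotation α)^[N] x) /
      birkhoffSum (torusRotation α) phi N x) atTop (nhds 0) := by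
    simp only [torusRotation_iterate, birkhoffSum_torusRotation]
    rw [Metric.tendsto_atTop']
    intro ε hε
    obtain ⟨m, hm⟩ := exists_nat_one_div_lt hε
    obtain ⟨N₀, hN₀⟩ := eventually_atTop.1 (hx m)
    refine ⟨N₀ + 1, fun N hN => ?_⟩
    have h1 := hN₀ N (by omega)
    have h2 := natCast_le_sum_phi α N x
    have h3 : (0 : ℝ) < N := by exact_mod_cast (by omega : 0 < N)
    have h4 := one_le_phi (x + orbitPoint α N)
    rw [Real.dist_eq, sub_zero, abs_of_nonneg (div_nonneg (by linarith) (by linarith)),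
      div_lt_iff₀ (by linarith)]
    refine h1.trans_lt ?_
    exact mul_lt_mul_of_pos_right hm (by linarith)
  have := (continuous_coe_real_ereal.tendsto 0).comp hlim
  exact this.limsup_eq

end IsDenomSeq

/-! ### A divergence Borel–Cantelli lemma -/

section KochenStone

variable {Ω : Type*} [MeasurableSpace Ω] {μ : Measure Ω}

/-- Cauchy–Schwarz for the counting function `∑ 1_{A i}` and the indicator of the union, obtained
from the discriminant of `t ↦ ∫ (∑ 1_{A i} - t 1_U)²`. -/
theorem sq_sum_measureReal_le [IsProbabilityMeasure μ] {ι : Type*} (T : Finset ι) {A : ι → Set Ω}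
    (hA : ∀ i, MeasurableSet (A i)) :
    (∑ i ∈ T, μ.real (A i)) ^ 2 ≤
      μ.real (⋃ i ∈ T, A i) * ∑ i ∈ T, ∑ j ∈ T, μ.real (A i ∩ A j) := by
  set U := ⋃ i ∈ T, A i with hU
  have hUm : MeasurableSet U := T.measurableSet_biUnion fun i _ => hA i
  set ind : Set Ω → Ω → ℝ := fun s => s.indicator fun _ => (1 : ℝ) with hind
  have hint : ∀ s, MeasurableSet s → Integrable (ind s) μ := fun s hs =>
    (integrable_const (1 : ℝ)).indicator hs
  have hval : ∀ s, MeasurableSet s → ∫ x, ind s x ∂μ = μ.real s := fun s hs => by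
    simp only [hind]; rw [integral_indicator_const _ hs]; simp
  have hAA : ∀ i j, MeasurableSet (A i ∩ A j) := fun i j => (hA i).inter (hA j)
  have hi1 : Integrable (fun x => ∑ i ∈ T, ind (A i) x) μ :=
    integrable_finsetSum _ fun i _ => hint _ (hA i)
  have hi2 : Integrable (fun x => ∑ i ∈ T, ∑ j ∈ T, ind (A i ∩ A j) x) μ :=
    integrable_finsetSum _ fun i _ => integrable_finsetSum _ fun j _ => hint _ (hAA i j)
  have hpt : ∀ t : ℝ, ∀ x, (∑ i ∈ T, ind (A i) x - t * ind U x) ^ 2 =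
      ∑ i ∈ T, ∑ j ∈ T, ind (A i ∩ A j) x - 2 * t * ∑ i ∈ T, ind (A i) x + t ^ 2 * ind U x := by
    intro t x
    have h1 : (∑ i ∈ T, ind (A i) x) * ∑ i ∈ T, ind (A i) x = ∑ i ∈ T, ∑ j ∈ T, ind (A i ∩ A j) x := by
      rw [Finset.sum_mul_sum]
      refine Finset.sum_congr rfl fun i _ => Finset.sum_congr rfl fun j _ => ?_
      simp only [hind]
      by_cases hi : x ∈ A i <;> by_cases hj : x ∈ A j <;> simp [hi, hj]
    have h2 : (∑ i ∈ T, ind (A i) x) * ind U x = ∑ i ∈ T, ind (A i) x := by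
      rw [Finset.sum_mul]
      refine Finset.sum_congr rfl fun i hi => ?_
      simp only [hind]
      by_cases hx : x ∈ A i
      · have : x ∈ U := Set.mem_biUnion (s := (T : Set ι)) hi hx
        simp [hx, this]
      · simp [hx]
    have h3 : ind U x * ind U x = ind U x := by
      by_cases hx : x ∈ U <;> simp [hind, hx]
    linear_combination h1 - 2 * t * h2 + t ^ 2 * h3
  have hquad : ∀ t : ℝ, 0 ≤ μ.real U * (t * t) + (-2 * ∑ i ∈ T, μ.real (A i)) * t +
      ∑ i ∈ T, ∑ j ∈ T, μ.real (A i ∩ A j) := by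
    intro t
    have h0 : 0 ≤ ∫ x, (∑ i ∈ T, ind (A i) x - t * ind U x) ^ 2 ∂μ :=
      integral_nonneg fun x => sq_nonneg _
    simp only [hpt] at h0
    have hi3 : Integrable (fun x => ∑ i ∈ T, ∑ j ∈ T, ind (A i ∩ A j) x -
        2 * t * ∑ i ∈ T, ind (A i) x) μ := hi2.sub (hi1.const_mul _)
    rw [integral_add hi3 ((hint U hUm).const_mul _),
      integral_sub hi2 (hi1.const_mul _), integral_const_mul, integral_const_mul,
      integral_finsetSum _ fun i _ => hint _ (hA i), hval U hUm,
      integral_finsetSum _ fun i _ => integrable_finsetSum _ fun j _ => hint _ (hAA i j)] at h0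
    have e1 : ∑ i ∈ T, ∫ x, ∑ j ∈ T, ind (A i ∩ A j) x ∂μ =
        ∑ i ∈ T, ∑ j ∈ T, μ.real (A i ∩ A j) := by
      refine Finset.sum_congr rfl fun i _ => ?_
      rw [integral_finsetSum _ fun j _ => hint _ (hAA i j)]
      exact Finset.sum_congr rfl fun j _ => hval _ (hAA i j)
    have e2 : ∑ i ∈ T, ∫ x, ind (A i) x ∂μ = ∑ i ∈ T, μ.real (A i) :=
      Finset.sum_congr rfl fun i _ => hval _ (hA i)
    rw [e1, e2] at h0
    linarith
  have := discrim_le_zero hquad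
  rw [discrim] at this
  nlinarith

theorem sum_sum_measureReal_inter_le (A : ℕ → Set Ω) (a b : ℕ) (hab : a ≤ b) :
    ∑ i ∈ Finset.Ico a b, ∑ j ∈ Finset.Ico a b, μ.real (A i ∩ A j) ≤
      ∑ n ∈ Finset.Ico a b, (μ.real (A n) + 2 * ∑ m ∈ Finset.range n, μ.real (A m ∩ A n)) := by
  induction b, hab using Nat.le_induction with
  | base => simp
  | succ b hb ih =>
    rw [Finset.sum_Ico_succ_top hb]
    simp only [Finset.sum_Ico_succ_top hb]
    rw [Finset.sum_add_distrib, Set.inter_self]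
    have h1 : ∑ i ∈ Finset.Ico a b, μ.real (A i ∩ A b) ≤ ∑ m ∈ Finset.range b, μ.real (A m ∩ A b) := by
      refine Finset.sum_le_sum_of_subset_of_nonneg ?_ fun _ _ _ => measureReal_nonneg
      intro i hi
      exact Finset.mem_range.2 (Finset.mem_Ico.1 hi).2
    have h2 : ∑ i ∈ Finset.Ico a b, μ.real (A b ∩ A i) = ∑ i ∈ Finset.Ico a b, μ.real (A i ∩ A b) :=
      Finset.sum_congr rfl fun i _ => by rw [Set.inter_comm]
    linarith

/-- Kochen–Stone: divergence and quasi-independence bound the measure of every tail union below by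
`1 / (1 + 4 K)`, and continuity from above passes this to the limsup set. -/
theorem measure_frequently_mem_pos [IsProbabilityMeasure μ] {A : ℕ → Set Ω} (hA : ∀ n, MeasurableSet (A n))
    (hdiv : ¬ Summable fun n => μ.real (A n)) {K : ℝ} (hK0 : 0 ≤ K)
    (hK : ∀ n, ∑ m ∈ Finset.range n, μ.real (A m ∩ A n) ≤
      K * (∑ m ∈ Finset.range n, μ.real (A m) + 1) * μ.real (A n)) :
    0 < μ {x | ∃ᶠ n in atTop, x ∈ A n} := by
  have htail : ∀ n₀, 1 / (1 + 4 * K) ≤ μ.real (⋃ n ≥ n₀, A n) := by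
    intro n₀
    have hlim := (not_summable_iff_tendsto_nat_atTop_of_nonneg
      (fun n => measureReal_nonneg (μ := μ) (s := A n))).1 hdiv
    set C₀ := ∑ n ∈ Finset.range n₀, μ.real (A n) with hC₀
    -- The window is long enough for its mass `s` to exceed `C₀ + 2`, so that `C₀` and the additive
    -- constants are absorbed into multiples of `s`.
    obtain ⟨n₁, hn₁, hge⟩ := ((eventually_ge_atTop n₀).and
      (hlim.eventually_ge_atTop (2 * C₀ + 2))).exists
    set s := ∑ n ∈ Finset.Ico n₀ n₁, μ.real (A n) with hs
    have hsplit : C₀ + s = ∑ n ∈ Finset.range n₁, μ.real (A n) :=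
      Finset.sum_range_add_sum_Ico _ hn₁
    have hC₀0 : 0 ≤ C₀ := Finset.sum_nonneg fun _ _ => measureReal_nonneg
    have hs1 : C₀ + 2 ≤ s := by linarith
    have hcs := sq_sum_measureReal_le (μ := μ) (Finset.Ico n₀ n₁) hA
    have hdouble := sum_sum_measureReal_inter_le (μ := μ) A n₀ n₁ hn₁
    have hbound : ∑ n ∈ Finset.Ico n₀ n₁,
        (μ.real (A n) + 2 * ∑ m ∈ Finset.range n, μ.real (A m ∩ A n)) ≤ s * (s + 4 * K * s) := by
      calc _ ≤ ∑ n ∈ Finset.Ico n₀ n₁, μ.real (A n) * (1 + 2 * (K * (C₀ + s + 1))) := by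
            refine Finset.sum_le_sum fun n hn => ?_
            have h1 := hK n
            have h2 : ∑ m ∈ Finset.range n, μ.real (A m) ≤ C₀ + s := by
              rw [hsplit]
              refine Finset.sum_le_sum_of_subset_of_nonneg ?_ fun _ _ _ => measureReal_nonneg
              exact Finset.range_subset_range.2 (Finset.mem_Ico.1 hn).2.le
            have h3 : K * (∑ m ∈ Finset.range n, μ.real (A m) + 1) * μ.real (A n) ≤
                K * (C₀ + s + 1) * μ.real (A n) := by
              have := measureReal_nonneg (μ := μ) (s := A n)
              gcongr
            linarith
        _ = s * (1 + 2 * (K * (C₀ + s + 1))) := by rw [← Finset.sum_mul]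
        _ ≤ s * (s + 4 * K * s) := by
            refine mul_le_mul_of_nonneg_left ?_ (by linarith)
            nlinarith
    set u := μ.real (⋃ n ∈ Finset.Ico n₀ n₁, A n) with hu
    have hu0 : 0 ≤ u := measureReal_nonneg
    have hfin : s ^ 2 ≤ u * (s * (s + 4 * K * s)) :=
      hcs.trans (mul_le_mul_of_nonneg_left (hdouble.trans hbound) hu0)
    have h1 : 1 / (1 + 4 * K) ≤ u := by
      rw [div_le_iff₀ (by positivity)]
      have hs2 : 0 < s ^ 2 := by nlinarith
      have e : u * (s * (s + 4 * K * s)) = u * (1 + 4 * K) * s ^ 2 := by ring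
      rw [e] at hfin
      by_contra hcon
      push Not at hcon
      nlinarith
    refine h1.trans (measureReal_mono ?_ (measure_ne_top _ _))
    refine Set.iUnion₂_subset fun n hn => ?_
    exact Set.subset_biUnion_of_mem (u := A) (show n ∈ {n | n ≥ n₀} from (Finset.mem_Ico.1 hn).1)
  have hset : {x | ∃ᶠ n in atTop, x ∈ A n} = ⋂ n₀, ⋃ n ≥ n₀, A n := by
    ext x
    simp [frequently_atTop]
  have hanti : Antitone fun n₀ => ⋃ n ≥ n₀, A n := fun a b hab =>
    Set.iUnion₂_mono' fun n hn => ⟨n, le_trans hab hn, le_rfl⟩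
  have hlim := tendsto_measure_iInter_atTop (μ := μ) (s := fun n₀ => ⋃ n ≥ n₀, A n)
    (fun n₀ => (MeasurableSet.iUnion fun n => MeasurableSet.iUnion fun _ => hA n).nullMeasurableSet)
    hanti ⟨0, measure_ne_top _ _⟩
  rw [hset]
  refine lt_of_lt_of_le (ENNReal.ofReal_pos.2 (by positivity : 0 < 1 / (1 + 4 * K)))
    (ge_of_tendsto' hlim fun n₀ => ?_)
  exact (ENNReal.ofReal_le_iff_le_toReal (measure_ne_top _ _)).2 (htail n₀)

end KochenStone

/-! ### Counting the visits of an orbit to a ball -/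

theorem card_le_of_separated {ι : Type*} {F : Finset ι} {z : ι → UnitAddCircle} {s R : ℝ}
    (hs : 0 < s) (hR : 0 ≤ R) (h1 : ∀ i ∈ F, ‖z i‖ ≤ R)
    (h2 : ∀ i ∈ F, ∀ j ∈ F, i ≠ j → s ≤ ‖z i - z j‖) : (F.card : ℝ) ≤ 2 * R / s + 2 := by
  choose u hu hun using fun i => UnitAddCircle.exists_coe_eq_abs_eq_norm (z i)
  have hcard : F.card ≤ (Finset.Icc ⌊-R / s⌋ ⌊R / s⌋).card := by
    refine Finset.card_le_card_of_injOn (fun i => ⌊u i / s⌋) ?_ ?_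
    · intro i hi
      have h := h1 i hi
      rw [← hun, abs_le] at h
      refine Finset.mem_coe.2 (Finset.mem_Icc.2 ⟨Int.floor_le_floor ?_, Int.floor_le_floor ?_⟩)
      · gcongr; exact h.1
      · gcongr; exact h.2
    · intro i hi j hj hij
      by_contra hne
      have h := h2 i hi j hj hne
      rw [← hu, ← hu, ← AddCircle.coe_sub] at h
      have h' := h.trans (UnitAddCircle.norm_coe_le_abs _)
      have h3 := Int.abs_sub_lt_one_of_floor_eq_floor hij
      rw [← sub_div, abs_div, abs_of_pos hs, div_lt_one hs] at h3
      linarith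
  have hle : ⌊-R / s⌋ ≤ ⌊R / s⌋ := Int.floor_le_floor (by gcongr; linarith)
  have hc : (((Finset.Icc ⌊-R / s⌋ ⌊R / s⌋).card : ℤ) : ℝ) = ⌊R / s⌋ + 1 - ⌊-R / s⌋ := by
    rw [Int.card_Icc, Int.toNat_of_nonneg (by omega)]; push_cast; ring
  have e1 := Int.floor_le (R / s)
  have e2 := Int.lt_floor_add_one (-R / s)
  have e3 : (F.card : ℝ) ≤ (((Finset.Icc ⌊-R / s⌋ ⌊R / s⌋).card : ℤ) : ℝ) := by exact_mod_cast hcard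
  have e4 : -R / s = -(R / s) := by ring
  have e5 : 2 * R / s = 2 * (R / s) := by ring
  rw [e4] at e2 hc e3
  rw [e5]
  linarith

namespace IsDenomSeq

variable {α : ℝ} {q : ℕ → ℕ}

theorem card_visits_le (H : IsDenomSeq α q) (n : ℕ) (z : UnitAddCircle) {R : ℝ} (hR : 0 ≤ R)
    (P len : ℕ) (hlen : len ≤ q (n + 1)) :
    (((Finset.Ico P (P + len)).filter fun N => ‖z + orbitPoint α N‖ ≤ R).card : ℝ) ≤
      4 * q (n + 1) * R + 2 := by
  have hl := H.one_le_cast (n + 1)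
  have := card_le_of_separated (F := (Finset.Ico P (P + len)).filter fun N => ‖z + orbitPoint α N‖ ≤ R)
    (z := fun N => z + orbitPoint α N) (s := 1 / (2 * q (n + 1))) (by positivity) hR
    (fun N hN => (Finset.mem_filter.1 hN).2)
    (fun i hi j hj hij => by
      rw [Finset.mem_filter, Finset.mem_Ico] at hi hj
      have e : z + orbitPoint α i - (z + orbitPoint α j) = orbitPoint α i - orbitPoint α j := by abel
      rw [e]
      exact H.norm_orbitPoint_sub_ge n hij (by omega) (by omega))
  have e : 2 * R / (1 / (2 * q (n + 1) : ℝ)) = 4 * q (n + 1) * R := by field_simp; ring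
  rwa [e] at this

/-- Two windows of length `l = q (n + 1)` cover the range, and separation bounds the visits in each
by `4 l R + 2`. All weights lie between `1/(3P)` and `1/P` because `len < 2 l ≤ 2 P`, so counting
and harmonic weight are comparable. -/
theorem sum_visits_le_of_lt (H : IsDenomSeq α q) (n : ℕ) (z : UnitAddCircle) {R : ℝ} (hR : 0 ≤ R)
    {P len : ℕ} (hP : q (n + 1) ≤ P) (h1 : q (n + 1) ≤ len) (h2 : len < 2 * q (n + 1)) :
    ∑ N ∈ (Finset.Ico P (P + len)).filter (fun N => ‖z + orbitPoint α N‖ ≤ R), (1 : ℝ) / N ≤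
      24 * (R + 1 / q (n + 1)) * ∑ N ∈ Finset.Ico P (P + len), (1 : ℝ) / N := by
  set l := q (n + 1) with hl
  have hl1 : (1 : ℝ) ≤ l := H.one_le_cast (n + 1)
  have hPl : (l : ℝ) ≤ P := by exact_mod_cast hP
  have hP0 : (0 : ℝ) < P := by linarith
  have hcard : (((Finset.Ico P (P + len)).filter fun N => ‖z + orbitPoint α N‖ ≤ R).card : ℝ) ≤
      2 * (4 * l * R + 2) := by
    have hsub : ((Finset.Ico P (P + len)).filter fun N => ‖z + orbitPoint α N‖ ≤ R) ⊆
        ((Finset.Ico P (P + l)).filter fun N => ‖z + orbitPoint α N‖ ≤ R) ∪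
        ((Finset.Ico (P + l) (P + l + l)).filter fun N => ‖z + orbitPoint α N‖ ≤ R) := by
      intro N hN
      simp only [Finset.mem_union, Finset.mem_filter, Finset.mem_Ico] at hN ⊢
      rcases lt_or_ge N (P + l) with h | h
      · exact Or.inl ⟨⟨hN.1.1, h⟩, hN.2⟩
      · exact Or.inr ⟨⟨h, by omega⟩, hN.2⟩
    have hc1 := H.card_visits_le n z hR P l le_rfl
    have hc2 := H.card_visits_le n z hR (P + l) l le_rfl
    have hc3 : (((Finset.Ico P (P + len)).filter fun N => ‖z + orbitPoint α N‖ ≤ R).card : ℝ) ≤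
        ((Finset.Ico P (P + l)).filter fun N => ‖z + orbitPoint α N‖ ≤ R).card +
        ((Finset.Ico (P + l) (P + l + l)).filter fun N => ‖z + orbitPoint α N‖ ≤ R).card := by
      exact_mod_cast (Finset.card_le_card hsub).trans (Finset.card_union_le _ _)
    linarith
  have hlow : (l : ℝ) / (3 * P) ≤ ∑ N ∈ Finset.Ico P (P + len), (1 : ℝ) / N := by
    calc (l : ℝ) / (3 * P) ≤ len * (1 / (3 * P)) := by
          rw [div_eq_mul_one_div]; gcongr
      _ = ∑ N ∈ Finset.Ico P (P + len), (1 : ℝ) / (3 * P) := by simp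
      _ ≤ _ := by
          refine Finset.sum_le_sum fun N hN => ?_
          rw [Finset.mem_Ico] at hN
          have hN0 : (0 : ℝ) < N := by exact_mod_cast (H.pos (n + 1)).trans_le (hP.trans hN.1)
          refine one_div_le_one_div_of_le hN0 ?_
          exact_mod_cast (by omega : N ≤ 3 * P)
  calc _ ≤ ∑ N ∈ (Finset.Ico P (P + len)).filter (fun N => ‖z + orbitPoint α N‖ ≤ R), (1 : ℝ) / P := by
        refine Finset.sum_le_sum fun N hN => ?_
        rw [Finset.mem_filter, Finset.mem_Ico] at hN
        exact one_div_le_one_div_of_le hP0 (by exact_mod_cast hN.1.1)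
    _ ≤ 2 * (4 * l * R + 2) * (1 / P) := by
        rw [Finset.sum_const, nsmul_eq_mul]; gcongr
    _ ≤ 24 * (R + 1 / l) * (l / (3 * P)) := by
        have e : 24 * (R + 1 / l) * ((l : ℝ) / (3 * P)) = (8 * l * R + 8) * (1 / P) := by
          field_simp; ring
        rw [e]; gcongr; linarith
    _ ≤ _ := by gcongr

/-- Windows of length `q (n + 1)` are peeled off until fewer than two remain. -/
theorem sum_visits_le (H : IsDenomSeq α q) (n : ℕ) (z : UnitAddCircle) {R : ℝ} (hR : 0 ≤ R)
    (len : ℕ) : ∀ P, q (n + 1) ≤ P → q (n + 1) ≤ len →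
    ∑ N ∈ (Finset.Ico P (P + len)).filter (fun N => ‖z + orbitPoint α N‖ ≤ R), (1 : ℝ) / N ≤
      24 * (R + 1 / q (n + 1)) * ∑ N ∈ Finset.Ico P (P + len), (1 : ℝ) / N := by
  induction len using Nat.strong_induction_on with
  | _ len ih =>
    intro P hP h1
    have hpos := H.pos (n + 1)
    rcases lt_or_ge len (2 * q (n + 1)) with h2 | h2
    · exact H.sum_visits_le_of_lt n z hR hP h1 h2
    · obtain ⟨m, rfl⟩ := Nat.exists_eq_add_of_le h1
      have hA := H.sum_visits_le_of_lt n z hR hP le_rfl (by omega)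
      have hB := ih m (by omega) (P + q (n + 1)) (by omega) (by omega)
      rw [add_assoc] at hB
      rw [Finset.sum_filter] at hA hB ⊢
      rw [← Finset.sum_Ico_consecutive _ (by omega : P ≤ P + q (n + 1))
          (by omega : P + q (n + 1) ≤ P + (q (n + 1) + m)),
        ← Finset.sum_Ico_consecutive _ (by omega : P ≤ P + q (n + 1))
          (by omega : P + q (n + 1) ≤ P + (q (n + 1) + m)), mul_add]
      exact add_le_add hA hB

end IsDenomSeq

/-! ### The times at which close returns are harmless -/

/-- The ratio `q_{n+1} / (q_n log q_n)`. -/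
noncomputable def growthRatio (q : ℕ → ℕ) (n : ℕ) : ℝ := q (n + 1) / (q n * Real.log (q n))

/-- The least time in `[q_n, q_{n+1}]` from which on the returns close to the origin do not
dominate the Birkhoff sums up to time `q_{n+1}`. -/
noncomputable def startTime (q : ℕ → ℕ) (n : ℕ) : ℕ :=
  if growthRatio q n < 2 then q n
  else if 2 * ⌈growthRatio q n * (1 + Real.log (growthRatio q n)) * q n⌉₊ ≤ q (n + 1) then
    ⌈growthRatio q n * (1 + Real.log (growthRatio q n)) * q n⌉₊
  else q (n + 1)

namespace IsDenomSeq

variable {α : ℝ} {q : ℕ → ℕ}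

theorem _root_.one_le_log_of_three_le {m : ℕ} (hn : 3 ≤ m) : 1 ≤ Real.log m := by
  have hQ3 : (3 : ℝ) ≤ m := by exact_mod_cast hn
  rw [Real.le_log_iff_exp_le (by linarith)]
  linarith [Real.exp_one_lt_d9]

theorem growthRatio_mul (H : IsDenomSeq α q) {n : ℕ} (hn : 3 ≤ q n) :
    growthRatio q n * q n * Real.log (q n) = q (n + 1) := by
  have := one_le_log_of_three_le hn
  have := H.one_le_cast n
  rw [growthRatio]; field_simp

theorem le_ceil_growthRatio (H : IsDenomSeq α q) {n : ℕ} (hZ : 2 ≤ growthRatio q n) :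
    q n ≤ ⌈growthRatio q n * (1 + Real.log (growthRatio q n)) * q n⌉₊ := by
  have hlZ : 0 < Real.log (growthRatio q n) := Real.log_pos (by linarith)
  have h1 := H.one_le_cast n
  have h2 : (1 : ℝ) ≤ growthRatio q n * (1 + Real.log (growthRatio q n)) := by nlinarith
  have h3 : (q n : ℝ) ≤ ⌈growthRatio q n * (1 + Real.log (growthRatio q n)) * q n⌉₊ :=
    le_trans (by nlinarith) (Nat.le_ceil _)
  exact_mod_cast h3

theorem le_startTime (H : IsDenomSeq α q) (n : ℕ) : q n ≤ startTime q n := by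
  rw [startTime]
  split_ifs with h1 h2
  · exact le_rfl
  · exact H.le_ceil_growthRatio (not_lt.1 h1)
  · exact H.mono' n

theorem startTime_le (H : IsDenomSeq α q) (n : ℕ) : startTime q n ≤ q (n + 1) := by
  rw [startTime]
  split_ifs with h1 h2
  · exact H.mono' n
  · omega
  · exact le_rfl

/-- This is the purpose of the factor 2 in `startTime`: a nonempty range of times is long enough for
visits to be counted with windows of length `q n`. -/
theorem startTime_add_le (H : IsDenomSeq α q) (n : ℕ) (h : startTime q (n + 1) < q (n + 2)) :
    startTime q (n + 1) + q n ≤ q (n + 2) := by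
  have h0 := H.add_le n
  have h0' := H.two_mul_le n
  revert h
  rw [startTime]
  split_ifs with h1 h2
  · omega
  · simp only [add_assoc, Nat.reduceAdd] at h2 ⊢; omega
  · intro h; simp only [add_assoc, Nat.reduceAdd] at h; omega

/-- This lets the return term of `birkhoff_upper_bound` be absorbed by `N log q_n`. With `β = N / Q`
it reads `Z (1 + log (β + 1)) ≤ 4 β`. For `Z < 2` it follows from `log (β + 1) ≤ β` and `β ≥ 1`. For
`Z ≥ 2` one has `β ≥ Z (1 + log Z)`, and `log (β + 1)` is split as `log Z + log ((β + 1) / Z)`. -/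
theorem mul_log_le_of_startTime_le (H : IsDenomSeq α q) {n N : ℕ} (hn : 3 ≤ q n)
    (hN : startTime q n ≤ N) (hN' : N < q (n + 1)) :
    q (n + 1) * (1 + Real.log (N / q n + 1)) ≤ 4 * (N * Real.log (q n)) := by
  have hL := one_le_log_of_three_le hn
  have hQ := H.one_le_cast n
  have hmul := H.growthRatio_mul hn
  set L := Real.log (q n) with hLdef
  set Z := growthRatio q n with hZ
  set Q : ℝ := (q n : ℝ) with hQdef
  have hQN : Q ≤ N := by
    rw [hQdef]; exact_mod_cast (H.le_startTime n).trans hN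
  have hβ : 1 ≤ N / Q := by rw [le_div_iff₀ (by linarith)]; linarith
  set β : ℝ := N / Q with hβdef
  have hNβ : (N : ℝ) = β * Q := by rw [hβdef]; field_simp
  have hQL : 0 < Q * L := by positivity
  have hZ0 : 0 ≤ Z := by rw [hZ, growthRatio]; positivity
  rw [← hmul, hNβ]
  suffices h : Z * (1 + Real.log (β + 1)) ≤ 4 * β by
    calc Z * Q * L * (1 + Real.log (β + 1)) = Z * (1 + Real.log (β + 1)) * (Q * L) := by ring
      _ ≤ 4 * β * (Q * L) := by gcongr
      _ = _ := by ring
  rw [startTime, ← hZ, ← hQdef] at hN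
  split_ifs at hN with h1 h2
  · have := Real.log_le_sub_one_of_pos (x := β + 1) (by linarith)
    nlinarith
  · push Not at h1
    have hX : Z * (1 + Real.log Z) * Q ≤ N := (Nat.le_ceil _).trans (by exact_mod_cast hN)
    have hXβ : Z * (1 + Real.log Z) ≤ β := by rwa [hβdef, le_div_iff₀ (by linarith)]
    have e : Real.log (β + 1) = Real.log Z + Real.log ((β + 1) / Z) := by
      rw [← Real.log_mul (by linarith) (by positivity)]; congr 1; field_simp
    have h3 := Real.log_le_sub_one_of_pos (x := (β + 1) / Z) (by positivity)
    have h4 : Z * Real.log ((β + 1) / Z) ≤ β + 1 := by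
      calc Z * Real.log ((β + 1) / Z) ≤ Z * ((β + 1) / Z) := by gcongr; linarith
        _ = β + 1 := by field_simp
    rw [e]
    nlinarith
  · omega

set_option maxHeartbeats 800000 in
/-- `W_n` is controlled by the weight of the times from `startTime` on, up to a telescoping term. -/
theorem W_le (H : IsDenomSeq α q) (hq : ∀ n, cfDen α n = q n) {n : ℕ} (hn : 3 ≤ q n) :
    W α n ≤ 2 / Real.log (q n) * Real.log (q (n + 1) / startTime q n) +
      4 * (Real.exp 4 + 1) * (1 / Real.log (q n) - 1 / Real.log (q (n + 1))) := by
  have hL := one_le_log_of_three_le hn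
  have hQ3 : (3 : ℝ) ≤ q n := by exact_mod_cast hn
  have hQQ' : (q n : ℝ) ≤ q (n + 1) := H.cast_mono n.le_succ
  have hmul := H.growthRatio_mul hn
  have hPQ' : (startTime q n : ℝ) ≤ q (n + 1) := by exact_mod_cast H.startTime_le n
  have hQP : (q n : ℝ) ≤ startTime q n := by exact_mod_cast H.le_startTime n
  have hlogP : 0 ≤ Real.log (q (n + 1) / startTime q n) :=
    Real.log_nonneg (by rw [le_div_iff₀ (by linarith)]; linarith)
  have hLL' : Real.log (q n) ≤ Real.log (q (n + 1)) := Real.log_le_log (by linarith) hQQ'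
  have htel : 0 ≤ 1 / Real.log (q n) - 1 / Real.log (q (n + 1)) :=
    sub_nonneg.2 (one_div_le_one_div_of_le (by linarith) hLL')
  have hexp := Real.exp_pos 4
  have hfirst : 0 ≤ 2 / Real.log (q n) * Real.log (q (n + 1) / startTime q n) := by positivity
  have hlast : 0 ≤ 4 * (Real.exp 4 + 1) * (1 / Real.log (q n) - 1 / Real.log (q (n + 1))) := by
    positivity
  have hcond : (q (n + 1) : ℝ) < 2 * q n * Real.log (q n) ↔ growthRatio q n < 2 := by
    rw [growthRatio, div_lt_iff₀ (by positivity), mul_assoc]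
  rw [W, hq, hq]
  split_ifs with hcase
  · have hst : startTime q n = q n := by rw [startTime, if_pos (hcond.1 hcase)]
    rw [hst] at hfirst ⊢
    rw [← Real.log_div (by linarith) (by linarith)]
    have e : 2 / Real.log (q n) * Real.log (q (n + 1) / q n) =
        2 * (Real.log (q (n + 1) / q n) / Real.log (q n)) := by ring
    have : 0 ≤ Real.log (q (n + 1) / q n) / Real.log (q n) := by linarith
    linarith
  · rw [hcond] at hcase
    have hst : startTime q n = if 2 * ⌈growthRatio q n * (1 + Real.log (growthRatio q n)) * q n⌉₊ ≤
        q (n + 1) then ⌈growthRatio q n * (1 + Real.log (growthRatio q n)) * q n⌉₊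
        else q (n + 1) := by rw [startTime, if_neg hcase]
    push Not at hcase
    change max 1 (Real.log (Real.log (q n)) - Real.log (Real.log (growthRatio q n))) /
      Real.log (q n) ≤ _
    set L := Real.log (q n) with hLdef
    set L' := Real.log (q (n + 1)) with hL'def
    set Z := growthRatio q n with hZ
    set Q : ℝ := (q n : ℝ) with hQdef
    set Q' : ℝ := (q (n + 1) : ℝ) with hQ'def
    have hlZ : 0.6931471803 < Real.log Z :=
      Real.log_two_gt_d9.trans_le (Real.log_le_log (by norm_num) hcase)
    have hlZ0 : 0 < Real.log Z := by linarith
    have hL0 : 0 < L := by linarith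
    set D := Real.log L - Real.log (Real.log Z) with hD
    have hDdiv : D = Real.log (L / Real.log Z) := by rw [hD, Real.log_div hL0.ne' hlZ0.ne']
    -- If `D < 4`, then `log Z` is at least `e⁻⁴ L`, so `log q_{n+1}` exceeds `log q_n` by a fixed
    -- factor and `1/L` is bounded by a multiple of the telescoping difference. If `D ≥ 4`, the
    -- harmonic weight after `startTime` is large enough.
    rcases lt_or_ge D 4 with hD4 | hD4
    · have hmax : max 1 D ≤ 4 := max_le (by norm_num) hD4.le
      have hLZ : L ≤ Real.exp 4 * Real.log Z := by
        rw [hDdiv, Real.log_lt_iff_lt_exp (by positivity), div_lt_iff₀ hlZ0] at hD4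
        exact hD4.le
      have hL'ge : L + Real.log Z ≤ L' := by
        rw [hLdef, ← Real.log_mul (by linarith) (by linarith)]
        refine Real.log_le_log (by positivity) ?_
        have h0 : Q * Z ≤ Z * Q * L := by
          nlinarith [mul_pos (by linarith : 0 < Z) (by linarith : 0 < Q)]
        exact h0.trans hmul.le
      have h1 : (Real.exp 4 + 1) * L ≤ Real.exp 4 * L' := by nlinarith
      have hL'0 : 0 < L' := by linarith
      have h2 : 1 / L ≤ (Real.exp 4 + 1) * (1 / L - 1 / L') := by
        have e : (Real.exp 4 + 1) * (1 / L - 1 / L') - 1 / L =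
            (Real.exp 4 * L' - (Real.exp 4 + 1) * L) / (L * L') := by field_simp; ring
        have : 0 ≤ (Real.exp 4 * L' - (Real.exp 4 + 1) * L) / (L * L') :=
          div_nonneg (by linarith) (by positivity)
        linarith
      have h3 : max 1 D / L ≤ 4 * (1 / L) := by
        rw [mul_one_div]; gcongr
      linarith
    · have hmax : max 1 D = D := max_eq_right (by linarith)
      have he4 : 13 ≤ Real.exp 4 := by
        have := Real.quadratic_le_exp_of_nonneg (x := 4) (by norm_num)
        norm_num at this; linarith
      have hLZ : 13 * Real.log Z ≤ L := by
        rw [hDdiv, Real.le_log_iff_exp_le (by positivity), le_div_iff₀ hlZ0] at hD4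
        nlinarith
      set X := Z * (1 + Real.log Z) with hX
      have hXQ1 : 1 ≤ X * Q := by
        have : 1 ≤ X := by rw [hX]; nlinarith
        nlinarith
      have hceil : (⌈X * Q⌉₊ : ℝ) ≤ 2 * (X * Q) := by
        have := (Nat.ceil_lt_add_one (by linarith : 0 ≤ X * Q)).le
        linarith
      -- Since `log Z ≥ log 2 > 2/3`, one has `2 (1 + log Z) ≤ 5 log Z`.
      have hXL : 2 * (X * Q) * (L / (5 * Real.log Z)) ≤ Q' := by
        rw [← hmul, hX]
        have h5 : 2 * (1 + Real.log Z) / (5 * Real.log Z) ≤ 1 := by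
          rw [div_le_one (by positivity)]; linarith
        calc 2 * (Z * (1 + Real.log Z) * Q) * (L / (5 * Real.log Z))
            = Z * Q * L * (2 * (1 + Real.log Z) / (5 * Real.log Z)) := by ring
          _ ≤ Z * Q * L * 1 := by gcongr
          _ = _ := by ring
      have hge2 : 2 ≤ L / (5 * Real.log Z) := by
        rw [le_div_iff₀ (by positivity)]; linarith
      -- This excludes the degenerate branch of `startTime`, in which the range of times is empty.
      have hcond2 : 2 * ⌈X * Q⌉₊ ≤ q (n + 1) := by
        have : (2 * ⌈X * Q⌉₊ : ℝ) ≤ Q' := by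
          have h0 : 0 ≤ 2 * (X * Q) := by linarith
          nlinarith [mul_le_mul_of_nonneg_left hge2 h0]
        rw [hQ'def] at this
        exact_mod_cast this
      rw [if_pos hcond2] at hst
      have hceil0 : (0 : ℝ) < ⌈X * Q⌉₊ := lt_of_lt_of_le (by linarith) (Nat.le_ceil (X * Q))
      -- The loss `log 5 ≤ 2` is at most `D / 2`.
      have hlog : D / 2 ≤ Real.log (Q' / startTime q n) := by
        have h5 : Real.log 5 ≤ 2 := by
          rw [Real.log_le_iff_le_exp (by norm_num)]
          have := Real.quadratic_le_exp_of_nonneg (x := 2) (by norm_num)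
          norm_num at this; linarith
        have h6 : D - Real.log 5 = Real.log (L / (5 * Real.log Z)) := by
          rw [hDdiv, ← Real.log_div (by positivity) (by norm_num)]
          congr 1; field_simp
        have h7 : Real.log (L / (5 * Real.log Z)) ≤ Real.log (Q' / startTime q n) := by
          refine Real.log_le_log (by positivity) ?_
          rw [hst, le_div_iff₀ hceil0]
          calc L / (5 * Real.log Z) * ⌈X * Q⌉₊ ≤ L / (5 * Real.log Z) * (2 * (X * Q)) := by gcongr
            _ ≤ Q' := by linarith
        linarith
      rw [hmax]
      have : D / L ≤ 2 / L * Real.log (Q' / startTime q n) := by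
        calc D / L = 2 / L * (D / 2) := by ring
          _ ≤ _ := by gcongr
      linarith

end IsDenomSeq

/-! ### Target sets and their quasi-independence -/

/-- The ball of radius `c / (N log q_n)` about `-N α`. -/
def targetBall (α : ℝ) (q : ℕ → ℕ) (c : ℝ) (n N : ℕ) : Set UnitAddCircle :=
  Metric.closedBall (-orbitPoint α N) (c / (N * Real.log (q n)))

/-- The union of the target balls over the times from `startTime` up to `q_{n+1}`. -/
def targetSet (α : ℝ) (q : ℕ → ℕ) (c : ℝ) (n : ℕ) : Set UnitAddCircle :=
  ⋃ N ∈ Finset.Ico (startTime q n) (q (n + 1)), targetBall α q c n N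

theorem mem_targetBall {α : ℝ} {q : ℕ → ℕ} {c : ℝ} {n N : ℕ} {x : UnitAddCircle} :
    x ∈ targetBall α q c n N ↔ ‖x + orbitPoint α N‖ ≤ c / (N * Real.log (q n)) := by
  rw [targetBall, Metric.mem_closedBall, dist_eq_norm, sub_neg_eq_add]

theorem measurableSet_targetBall {α : ℝ} {q : ℕ → ℕ} {c : ℝ} {n N : ℕ} :
    MeasurableSet (targetBall α q c n N) := Metric.isClosed_closedBall.measurableSet

theorem measurableSet_targetSet {α : ℝ} {q : ℕ → ℕ} {c : ℝ} {n : ℕ} :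
    MeasurableSet (targetSet α q c n) :=
  Finset.measurableSet_biUnion _ fun _ _ => measurableSet_targetBall

namespace IsDenomSeq

variable {α : ℝ} {q : ℕ → ℕ}

/-- From `startTime` on, `4 N log q_n ≥ q_{n+1}`. The resulting bound is a quarter of the separation
`1/(2 q_{n+1})`, which makes the target balls of one level disjoint. -/
theorem radius_le (H : IsDenomSeq α q) {c : ℝ} (hc : c ≤ 1 / 32) {n N : ℕ}
    (hn : 3 ≤ q n) (hN : N ∈ Finset.Ico (startTime q n) (q (n + 1))) :
    c / (N * Real.log (q n)) ≤ 1 / (8 * q (n + 1)) := by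
  rw [Finset.mem_Ico] at hN
  have hL := one_le_log_of_three_le hn
  have hQ := H.one_le_cast n
  have hQ' := H.one_le_cast (n + 1)
  have hN1 : (1 : ℝ) ≤ N := hQ.trans (by exact_mod_cast (H.le_startTime n).trans hN.1)
  have h := H.mul_log_le_of_startTime_le hn hN.1 hN.2
  have hlog : 0 ≤ Real.log (N / q n + 1) := Real.log_nonneg (by
    have : (0 : ℝ) ≤ N / q n := by positivity
    linarith)
  rw [div_le_div_iff₀ (by positivity) (by positivity)]
  nlinarith

theorem measureReal_targetBall (H : IsDenomSeq α q) {c : ℝ} (hc0 : 0 ≤ c) (hc : c ≤ 1 / 32)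
    {n N : ℕ} (hn : 3 ≤ q n) (hN : N ∈ Finset.Ico (startTime q n) (q (n + 1))) :
    volume.real (targetBall α q c n N) = 2 * c / Real.log (q n) * (1 / N) := by
  have hL := one_le_log_of_three_le hn
  have hr := H.radius_le hc hn hN
  have hQ' := H.one_le_cast (n + 1)
  have h8 : 1 / (8 * q (n + 1) : ℝ) ≤ 1 / 8 := one_div_le_one_div_of_le (by norm_num) (by linarith)
  have hr0 : 0 ≤ c / (N * Real.log (q n)) := by positivity
  rw [Measure.real, targetBall, AddCircle.volume_closedBall, min_eq_right (by linarith),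
    ENNReal.toReal_ofReal (by linarith), mul_div_assoc', div_mul_div_comm, mul_one,
    mul_comm (N : ℝ)]

theorem measureReal_targetSet (H : IsDenomSeq α q) {c : ℝ} (hc0 : 0 ≤ c) (hc : c ≤ 1 / 32)
    {n : ℕ} (hn : 3 ≤ q n) : volume.real (targetSet α q c n) =
      2 * c / Real.log (q n) * ∑ N ∈ Finset.Ico (startTime q n) (q (n + 1)), (1 : ℝ) / N := by
  rw [targetSet, measureReal_biUnion_finset, Finset.mul_sum]
  · exact Finset.sum_congr rfl fun N hN => H.measureReal_targetBall hc0 hc hn hN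
  · intro i hi j hj hij
    refine Set.disjoint_left.2 fun x hxi hxj => ?_
    rw [mem_targetBall] at hxi hxj
    have hri := H.radius_le hc hn hi
    have hrj := H.radius_le hc hn hj
    have hi' := (Finset.mem_Ico.1 hi).2
    have hj' := (Finset.mem_Ico.1 hj).2
    have hQ' := H.one_le_cast (n + 1)
    have hsep := H.norm_orbitPoint_sub_ge n hij (by omega) (by omega)
    have h1 := norm_sub_le (x + orbitPoint α i) (x + orbitPoint α j)
    rw [add_sub_add_left_eq_sub] at h1
    have e : 1 / (2 * q (n + 1) : ℝ) = 4 * (1 / (8 * q (n + 1))) := by field_simp; norm_num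
    have : (0 : ℝ) < 1 / (8 * q (n + 1)) := by positivity
    linarith
  · exact fun _ _ => measurableSet_targetBall

/-- A target ball meeting the given ball belongs to a time `N` with `‖z + Nα‖ ≤ r + 1/q_{n+1}`, and
`sum_visits_le` bounds the harmonic weight of such times. One `1/q_{n+1}` comes from this
enlargement, the other from the count. -/
theorem measureReal_closedBall_inter_targetSet_le (H : IsDenomSeq α q) {c : ℝ} (hc0 : 0 ≤ c)
    (hc : c ≤ 1 / 32) {n : ℕ} (hn : 3 ≤ q (n + 2)) (z : UnitAddCircle) {r : ℝ} (hr : 0 ≤ r) :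
    volume.real (Metric.closedBall z r ∩ targetSet α q c (n + 2)) ≤
      24 * (r + 2 / q (n + 1)) * volume.real (targetSet α q c (n + 2)) := by
  have hL := one_le_log_of_three_le hn
  have hl := H.one_le_cast (n + 1)
  rcases (H.startTime_le (n + 2)).eq_or_lt with h | h
  · have : targetSet α q c (n + 2) = ∅ := by rw [targetSet, h]; simp
    simp [this]
  set P := startTime q (n + 2) with hP
  set I := Finset.Ico P (q (n + 3)) with hI
  set R := r + 1 / q (n + 1) with hR
  set F := I.filter (fun N => ‖z + orbitPoint α N‖ ≤ R) with hF
  have hsub : Metric.closedBall z r ∩ targetSet α q c (n + 2) ⊆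
      ⋃ N ∈ F, targetBall α q c (n + 2) N := by
    rintro x ⟨hxz, hx⟩
    obtain ⟨N, hN, hxN⟩ := Set.mem_iUnion₂.1 hx
    refine Set.mem_biUnion (show N ∈ (F : Set ℕ) from ?_) hxN
    refine Finset.mem_coe.2 (Finset.mem_filter.2 ⟨hN, ?_⟩)
    rw [mem_targetBall] at hxN
    rw [Metric.mem_closedBall, dist_eq_norm] at hxz
    have h1 := H.radius_le hc hn hN
    have h2 : 1 / (8 * q (n + 3) : ℝ) ≤ 1 / q (n + 1) := by
      refine one_div_le_one_div_of_le (by linarith) ?_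
      have := H.cast_mono (show n + 1 ≤ n + 3 by omega)
      linarith
    have e : z + orbitPoint α N = (x + orbitPoint α N) - (x - z) := by abel
    rw [e]
    exact (norm_sub_le _ _).trans (by rw [hR]; linarith)
  have hlen : P + (q (n + 3) - P) = q (n + 3) := Nat.add_sub_cancel' h.le
  have hPl : q (n + 1) ≤ P := (H.mono' (n + 1)).trans (H.le_startTime (n + 2))
  have hadd := H.startTime_add_le (n + 1) h
  have hvis := H.sum_visits_le n z (R := R) (by positivity) (q (n + 3) - P) P hPl
    (Nat.le_sub_of_add_le' hadd)
  rw [hlen] at hvis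
  calc volume.real (Metric.closedBall z r ∩ targetSet α q c (n + 2))
      ≤ volume.real (⋃ N ∈ F, targetBall α q c (n + 2) N) := measureReal_mono hsub (measure_ne_top _ _)
    _ ≤ ∑ N ∈ F, volume.real (targetBall α q c (n + 2) N) := measureReal_biUnion_finset_le _ _
    _ = 2 * c / Real.log (q (n + 2)) * ∑ N ∈ F, (1 : ℝ) / N := by
        rw [Finset.mul_sum]
        exact Finset.sum_congr rfl fun N hN =>
          H.measureReal_targetBall hc0 hc hn (Finset.mem_filter.1 hN).1
    _ ≤ 2 * c / Real.log (q (n + 2)) *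
        (24 * (R + 1 / q (n + 1)) * ∑ N ∈ I, (1 : ℝ) / N) := by gcongr
    _ = _ := by
        rw [H.measureReal_targetSet hc0 hc hn, hR]; ring

/-- The previous estimate is summed over the balls of level `m`. The radii add up to half the
measure of the target set, and there are at most `q (m + 1)` error terms. -/
theorem measureReal_targetSet_inter_le (H : IsDenomSeq α q) {c : ℝ} (hc0 : 0 ≤ c)
    (hc : c ≤ 1 / 32) {m n : ℕ} (hm : 3 ≤ q m) (hn : 3 ≤ q (n + 2)) :
    volume.real (targetSet α q c m ∩ targetSet α q c (n + 2)) ≤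
      (24 * volume.real (targetSet α q c m) + 48 * (q (m + 1) / q (n + 1))) *
        volume.real (targetSet α q c (n + 2)) := by
  have hl := H.one_le_cast (n + 1)
  have hL := one_le_log_of_three_le hm
  set I := Finset.Ico (startTime q m) (q (m + 1)) with hI
  set s := volume.real (targetSet α q c (n + 2)) with hs
  have hs0 : 0 ≤ s := measureReal_nonneg
  have e : targetSet α q c m ∩ targetSet α q c (n + 2) =
      ⋃ M ∈ I, targetBall α q c m M ∩ targetSet α q c (n + 2) := by
    conv_lhs => rw [targetSet]
    rw [Set.iUnion₂_inter]
  have hcard : (I.card : ℝ) ≤ q (m + 1) := by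
    rw [hI, Nat.card_Ico]; exact_mod_cast Nat.sub_le _ _
  rw [e]
  calc _ ≤ ∑ M ∈ I, volume.real (targetBall α q c m M ∩ targetSet α q c (n + 2)) :=
        measureReal_biUnion_finset_le _ _
    _ ≤ ∑ M ∈ I, (12 * volume.real (targetBall α q c m M) * s + 48 / q (n + 1) * s) := by
        refine Finset.sum_le_sum fun M hM => ?_
        refine (H.measureReal_closedBall_inter_targetSet_le hc0 hc hn _ (by positivity)).trans
          (le_of_eq ?_)
        rw [H.measureReal_targetBall hc0 hc hm hM, ← hs]
        have hM0 : (0 : ℝ) < M := by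
          exact_mod_cast (H.pos m).trans_le ((H.le_startTime m).trans (Finset.mem_Ico.1 hM).1)
        field_simp
        ring
    _ = 12 * volume.real (targetSet α q c m) * s + I.card * (48 / q (n + 1) * s) := by
        rw [Finset.sum_add_distrib, ← Finset.sum_mul, ← Finset.mul_sum, Finset.sum_const,
          nsmul_eq_mul, H.measureReal_targetSet hc0 hc hm, Finset.mul_sum (f := fun N : ℕ => 1 / (N : ℝ)),
          Finset.sum_congr rfl fun M hM => H.measureReal_targetBall hc0 hc hm hM]
    _ ≤ 24 * volume.real (targetSet α q c m) * s + q (m + 1) * (48 / q (n + 1) * s) := by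
        have : (0 : ℝ) ≤ volume.real (targetSet α q c m) := measureReal_nonneg
        gcongr
        norm_num
    _ = _ := by ring

theorem sum_measureReal_targetSet_inter_le (H : IsDenomSeq α q) {c : ℝ} (hc0 : 0 ≤ c)
    (hc : c ≤ 1 / 32) {n₀ : ℕ} (hn₀2 : 2 ≤ n₀) (hn₀ : ∀ n, n₀ ≤ n → 3 ≤ q n) (j : ℕ) :
    ∑ i ∈ Finset.range j,
        volume.real (targetSet α q c (i + n₀) ∩ targetSet α q c (j + n₀)) ≤
      145 * (∑ i ∈ Finset.range j, volume.real (targetSet α q c (i + n₀)) + 1) *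
        volume.real (targetSet α q c (j + n₀)) := by
  cases j with
  | zero => simp
  | succ j =>
    obtain ⟨k, rfl⟩ : ∃ k, n₀ = k + 1 := ⟨n₀ - 1, by omega⟩
    have hidx : j + 1 + (k + 1) = (j + k) + 2 := by ring
    have hl := H.one_le_cast (j + k + 1)
    set s := volume.real (targetSet α q c (j + 1 + (k + 1))) with hs
    have hs0 : 0 ≤ s := measureReal_nonneg
    -- For consecutive levels the error ratio of the general estimate could be unbounded, so this
    -- single pair is bounded trivially.
    have hlast : volume.real (targetSet α q c (j + (k + 1)) ∩ targetSet α q c (j + 1 + (k + 1))) ≤ s :=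
      measureReal_mono Set.inter_subset_right (measure_ne_top _ _)
    have hterm : ∀ i ∈ Finset.range j,
        volume.real (targetSet α q c (i + (k + 1)) ∩ targetSet α q c (j + 1 + (k + 1))) ≤
        24 * volume.real (targetSet α q c (i + (k + 1))) * s +
          48 * s / q (j + k + 1) * q (i + (k + 1) + 1) := fun i _ => by
      rw [hs, hidx]
      refine (H.measureReal_targetSet_inter_le hc0 hc (hn₀ _ (by omega)) (hn₀ _ (by omega))).trans
        (le_of_eq ?_)
      ring
    -- Fibonacci-type growth makes the error ratios sum to at most `3`, whence `145 = 48 · 3 + 1`.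
    have hqsum : ∑ i ∈ Finset.range j, (q (i + (k + 1) + 1) : ℝ) ≤ 3 * q (j + k + 1) := by
      have h1 : ∑ i ∈ Finset.range j, q (i + (k + 1) + 1) ≤
          ∑ m ∈ Finset.range (j + k + 1 + 1), q m := by
        rw [show j + k + 1 + 1 = (k + 2) + j by ring, Finset.sum_range_add]
        refine le_add_of_nonneg_of_le (Nat.zero_le _) (le_of_eq ?_)
        exact Finset.sum_congr rfl fun i _ => by congr 1; ring
      exact_mod_cast h1.trans (H.sum_range_succ_le (j + k + 1))
    rw [Finset.sum_range_succ, Finset.sum_range_succ]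
    set S := ∑ i ∈ Finset.range j, volume.real (targetSet α q c (i + (k + 1))) with hS
    have hS0 : 0 ≤ S := Finset.sum_nonneg fun _ _ => measureReal_nonneg
    have hT0 : 0 ≤ volume.real (targetSet α q c (j + (k + 1))) := measureReal_nonneg
    have hmain : ∑ i ∈ Finset.range j,
        volume.real (targetSet α q c (i + (k + 1)) ∩ targetSet α q c (j + 1 + (k + 1))) ≤
        24 * S * s + 144 * s := by
      refine (Finset.sum_le_sum hterm).trans ?_
      rw [Finset.sum_add_distrib, ← Finset.sum_mul, ← Finset.mul_sum, ← Finset.mul_sum]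
      refine add_le_add le_rfl ?_
      calc 48 * s / q (j + k + 1) * ∑ i ∈ Finset.range j, (q (i + (k + 1) + 1) : ℝ)
          ≤ 48 * s / q (j + k + 1) * (3 * q (j + k + 1)) := by gcongr
        _ = 144 * s := by field_simp; ring
    nlinarith [mul_nonneg hS0 hs0, mul_nonneg hT0 hs0]

/-! ### Divergent case: from target sets to almost every point -/

theorem W_nonneg (H : IsDenomSeq α q) (hq : ∀ n, cfDen α n = q n) {n : ℕ} (hn : 3 ≤ q n) :
    0 ≤ W α n := by
  obtain ⟨K, -, hK⟩ := H.volume_largeSet_le hq one_pos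
  exact (hK n hn).1

/-- By `W_le`, `W` is dominated by a multiple of the measures plus differences of the bounded
decreasing sequence `1 / log q_n`, which are summable. -/
theorem not_summable_measureReal_targetSet (H : IsDenomSeq α q) (hq : ∀ n, cfDen α n = q n)
    {c : ℝ} (hc0 : 0 < c) (hc : c ≤ 1 / 32) {n₀ : ℕ} (hn₀ : ∀ n, n₀ ≤ n → 3 ≤ q n) (hdiv : ¬ Summable fun n : ℕ => W α (n + 1)) :
    ¬ Summable fun i => volume.real (targetSet α q c (i + n₀)) := by
  intro hsum
  apply hdiv
  have hlog : ∀ i, 1 ≤ Real.log (q (i + n₀)) := fun i => one_le_log_of_three_le (hn₀ _ (by omega))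
  have htel : Summable fun i : ℕ =>
      1 / Real.log (q (i + n₀)) - 1 / Real.log (q (i + n₀ + 1)) := by
    refine summable_of_sum_range_le (c := 1) (fun i => ?_) fun m => ?_
    · have := H.one_le_cast (i + n₀)
      exact sub_nonneg.2 (one_div_le_one_div_of_le (by linarith [hlog i])
        (Real.log_le_log (by linarith) (H.cast_mono (Nat.le_succ _))))
    · have e := Finset.sum_range_sub' (fun i => 1 / Real.log (q (i + n₀))) m
      have e' : ∀ i, i + 1 + n₀ = i + n₀ + 1 := fun i => by ring
      simp only [e'] at e
      rw [e]
      have h1 : 1 / Real.log (q (0 + n₀)) ≤ 1 := by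
        rw [div_le_one (by linarith [hlog 0])]; exact hlog 0
      have h2 : 0 ≤ 1 / Real.log (q (m + n₀)) := by have := hlog m; positivity
      linarith
  have hW : Summable fun i => W α (i + n₀) := by
    refine Summable.of_nonneg_of_le (fun i => H.W_nonneg hq (hn₀ _ (by omega))) (fun i => ?_)
      ((hsum.mul_left (1 / c)).add (htel.mul_left (4 * (Real.exp 4 + 1))))
    have hn := hn₀ (i + n₀) (by omega)
    refine (H.W_le hq hn).trans (add_le_add ?_ le_rfl)
    have hL := hlog i
    rw [H.measureReal_targetSet hc0.le hc hn]
    have h1 := log_div_le_sum_Ico_inv ((H.pos (i + n₀)).trans_le (H.le_startTime (i + n₀)))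
      (H.startTime_le (i + n₀))
    calc 2 / Real.log (q (i + n₀)) * Real.log (q (i + n₀ + 1) / startTime q (i + n₀))
        ≤ 2 / Real.log (q (i + n₀)) *
          ∑ N ∈ Finset.Ico (startTime q (i + n₀)) (q (i + n₀ + 1)), (1 : ℝ) / N := by gcongr
      _ = _ := by field_simp
  have hW' := (summable_nat_add_iff (f := fun n => W α n) n₀).1 hW
  exact (summable_nat_add_iff (f := fun n => W α n) 1).2 hW'

/-- The constant is `224 = 32 · 3 + 16 · 2 · 4`, from `birkhoff_upper_bound` and
`mul_log_le_of_startTime_le`. The factor `C + 1` instead of `C` leaves room for a finite initial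
piece of the orbit. -/
theorem mul_birkhoff_le_phi_of_mem_targetBall (H : IsDenomSeq α q) {C : ℝ} (hC : 0 ≤ C) {n N : ℕ}
    (hn : 3 ≤ q (n + 1)) (hN : N ∈ Finset.Ico (startTime q (n + 1)) (q (n + 2)))
    {x : UnitAddCircle} (hgen : ∀ k, x + orbitPoint α k ≠ 0)
    (hx : x ∈ targetBall α q (1 / (224 * (C + 1))) (n + 1) N) :
    (C + 1) * ∑ k ∈ Finset.range N, phi (x + orbitPoint α k) ≤ phi (x + orbitPoint α N) := by
  have hc : 1 / (224 * (C + 1)) ≤ 1 / 32 := one_div_le_one_div_of_le (by norm_num) (by linarith)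
  have hr := H.radius_le hc hn hN
  have hL := one_le_log_of_three_le hn
  rw [mem_targetBall] at hx
  have hN' := Finset.mem_Ico.1 hN
  have hqN : q (n + 1) ≤ N := (H.le_startTime (n + 1)).trans hN'.1
  have hN1 : (1 : ℝ) ≤ N := (H.one_le_cast (n + 1)).trans (by exact_mod_cast hqN)
  have hQ' := H.one_le_cast (n + 2)
  have h4 : 1 / (8 * q (n + 2) : ℝ) ≤ 1 / (4 * q (n + 2)) :=
    one_div_le_one_div_of_le (by linarith) (by linarith)
  have hub := H.birkhoff_upper_bound n hqN hN'.2 (x := x) (hx.trans (hr.trans h4))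
  have hml := H.mul_log_le_of_startTime_le hn hN'.1 hN'.2
  set L := Real.log (q (n + 1)) with hLdef
  have hlog : 0 ≤ Real.log (N / q (n + 1) + 1) := Real.log_nonneg (by
    have : (0 : ℝ) ≤ N / q (n + 1) := by positivity
    linarith)
  have hS : ∑ k ∈ Finset.range N, phi (x + orbitPoint α k) ≤ 224 * (N * L) := by
    have h1 : (N : ℝ) * (2 + L) ≤ 3 * (N * L) := by nlinarith
    have h2 : (q (n + 2) : ℝ) * (2 + Real.log (N / q (n + 1) + 1)) ≤
        2 * (q (n + 2) * (1 + Real.log (N / q (n + 1) + 1))) := by nlinarith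
    have h3 : (q (n + 2) : ℝ) * (1 + Real.log (N / q (n + 1) + 1)) ≤ 4 * (N * L) := hml
    linarith
  have hpos : 0 < ‖x + orbitPoint α N‖ := norm_pos_iff.2 (hgen N)
  have hphi := inv_norm_le_phi (hgen N)
  have h5 := one_div_le_one_div_of_le hpos hx
  have e : 1 / (1 / (224 * (C + 1)) / (N * L)) = (C + 1) * (224 * (N * L)) := by
    field_simp
  rw [e] at h5
  calc _ ≤ (C + 1) * (224 * (N * L)) := by gcongr
    _ ≤ _ := h5.trans hphi

/-- The set of points whose forward orbit meets `D` contains its own preimage under the ergodic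
rotation, so it is null or conull; it contains `D`. -/
theorem ae_exists_add_orbitPoint_mem (hα : Irrational α) {D : Set UnitAddCircle}
    (hD : MeasurableSet D) (hpos : 0 < volume D) :
    ∀ᵐ x : UnitAddCircle, ∃ k, x + orbitPoint α k ∈ D := by
  have herg : Ergodic (fun x : UnitAddCircle => x + (α : UnitAddCircle)) := by
    rw [AddCircle.ergodic_add_right, ← AddCircle.denseRange_zsmul_iff,
      AddCircle.denseRange_zsmul_coe_iff]
    simpa using hα
  set U : Set UnitAddCircle := ⋃ k, (fun x => x + orbitPoint α k) ⁻¹' D with hU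
  have hUm : MeasurableSet U :=
    MeasurableSet.iUnion fun k => (measurable_add_const (orbitPoint α k)) hD
  have hsub : (fun x : UnitAddCircle => x + (α : UnitAddCircle)) ⁻¹' U ⊆ U := by
    intro x hx
    obtain ⟨k, hk⟩ := Set.mem_iUnion.1 hx
    refine Set.mem_iUnion.2 ⟨1 + k, ?_⟩
    rw [Set.mem_preimage, orbitPoint_add, ← add_assoc]
    have e : orbitPoint α 1 = (α : UnitAddCircle) := by simp [orbitPoint]
    rw [e]
    exact hk
  have hDU : D ⊆ U := fun x hx => Set.mem_iUnion.2 ⟨0, by simpa [orbitPoint] using hx⟩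
  rcases herg.ae_empty_or_univ_of_preimage_ae_le hUm.nullMeasurableSet hsub.eventuallyLE with h | h
  · exact absurd (measure_mono_null hDU (ae_eq_empty.1 h)) hpos.ne'
  · filter_upwards [eventuallyEq_univ.1 h] with x hx
    exact Set.mem_iUnion.1 hx

theorem ae_frequently_mul_birkhoff_le (H : IsDenomSeq α q) (hα : Irrational α)
    (hq : ∀ n, cfDen α n = q n) (hdiv : ¬ Summable fun n : ℕ => W α (n + 1)) {C : ℝ} (hC : 0 ≤ C) :
    ∀ᵐ x : UnitAddCircle, ∃ᶠ N in atTop,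
      C * ∑ k ∈ Finset.range N, phi (x + orbitPoint α k) ≤ phi (x + orbitPoint α N) := by
  obtain ⟨n₀, hn₀2, hn₀⟩ := H.exists_three_le
  set c := 1 / (224 * (C + 1)) with hcdef
  have hc0 : 0 < c := by positivity
  have hc : c ≤ 1 / 32 := one_div_le_one_div_of_le (by norm_num) (by linarith)
  set A : ℕ → Set UnitAddCircle := fun i => targetSet α q c (i + n₀) with hA
  have hAm : ∀ i, MeasurableSet (A i) := fun i => measurableSet_targetSet
  have : IsProbabilityMeasure (volume : Measure UnitAddCircle) := ⟨UnitAddCircle.measure_univ⟩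
  have hpos := measure_frequently_mem_pos (μ := (volume : Measure UnitAddCircle)) hAm
    (H.not_summable_measureReal_targetSet hq hc0 hc hn₀ hdiv) (K := 145) (by norm_num)
    (H.sum_measureReal_targetSet_inter_le hc0.le hc hn₀2 hn₀)
  have hDm : MeasurableSet {x | ∃ᶠ i in atTop, x ∈ A i} := by
    have : {x | ∃ᶠ i in atTop, x ∈ A i} = limsup A atTop := by
      ext x; rw [mem_limsup_iff_frequently_mem]; rfl
    rw [this]
    exact MeasurableSet.measurableSet_limsup hAm
  filter_upwards [ae_exists_add_orbitPoint_mem hα hDm hpos, ae_add_orbitPoint_ne_zero α]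
    with x hx hgen
  obtain ⟨k, hk⟩ := hx
  set S₀ := ∑ j ∈ Finset.range k, phi (x + orbitPoint α j) with hS₀
  rw [frequently_atTop]
  intro N₀
  -- The level is taken so high that `N ≥ (C + 1) S₀`. As the Birkhoff sum from time `k` on is at
  -- least `N`, it absorbs the first `k` terms.
  obtain ⟨i, hi, hxi⟩ := frequently_atTop.1 hk (N₀ + ⌈(C + 1) * S₀⌉₊)
  obtain ⟨m, hm⟩ : ∃ m, i + n₀ = m + 1 := ⟨i + n₀ - 1, by omega⟩
  simp only [hA] at hxi
  rw [hm] at hxi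
  obtain ⟨N, hN, hxN⟩ := Set.mem_iUnion₂.1 hxi
  have hgen' : ∀ j, x + orbitPoint α k + orbitPoint α j ≠ 0 := fun j => by
    rw [add_assoc, ← orbitPoint_add]; exact hgen _
  have h := H.mul_birkhoff_le_phi_of_mem_targetBall hC (hn₀ _ (by omega)) hN hgen' hxN
  simp only [add_assoc, ← orbitPoint_add] at h
  have hNge : i ≤ N := by
    have h1 := (H.le_startTime (m + 1)).trans (Finset.mem_Ico.1 hN).1
    have h2 := H.self_le (m + 1)
    omega
  refine ⟨k + N, by omega, le_trans ?_ h⟩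
  rw [Finset.sum_range_add, ← hS₀]
  have hbig : (C + 1) * S₀ ≤ ∑ j ∈ Finset.range N, phi (x + orbitPoint α (k + j)) := by
    have h1 := natCast_le_sum_phi α N (x + orbitPoint α k)
    simp only [add_assoc, ← orbitPoint_add] at h1
    have h2 : (⌈(C + 1) * S₀⌉₊ : ℝ) ≤ N := by exact_mod_cast (by omega : ⌈(C + 1) * S₀⌉₊ ≤ N)
    linarith [Nat.le_ceil ((C + 1) * S₀)]
  have hS₀0 : 0 ≤ S₀ := Finset.sum_nonneg fun _ _ => zero_le_one.trans (one_le_phi _)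
  nlinarith

theorem ae_extravagance_eq_top (H : IsDenomSeq α q) (hα : Irrational α)
    (hq : ∀ n, cfDen α n = q n) (hdiv : ¬ Summable fun n : ℕ => W α (n + 1)) :
    ∀ᵐ x : UnitAddCircle, extravagance α x = ⊤ := by
  have h : ∀ᵐ x : UnitAddCircle, ∀ m : ℕ, ∃ᶠ N in atTop,
      (m : ℝ) * ∑ k ∈ Finset.range N, phi (x + orbitPoint α k) ≤ phi (x + orbitPoint α N) :=
    ae_all_iff.2 fun m => H.ae_frequently_mul_birkhoff_le hα hq hdiv (Nat.cast_nonneg m)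
  filter_upwards [h] with x hx
  rw [EReal.eq_top_iff_forall_lt]
  intro y
  obtain ⟨m, hm⟩ := exists_nat_gt y
  refine lt_of_lt_of_le (EReal.coe_lt_coe_iff.2 hm) ?_
  refine le_limsup_of_frequently_le ?_
  refine ((hx m).and_eventually (eventually_gt_atTop 0)).mono fun N hN => ?_
  rw [EReal.coe_le_coe_iff, torusRotation_iterate, birkhoffSum_torusRotation]
  have h1 := natCast_le_sum_phi α N x
  have h2 : (0 : ℝ) < N := by exact_mod_cast hN.2
  rw [le_div_iff₀ (by linarith)]
  exact hN.1

end IsDenomSeq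

theorem mainTheorem1 (α : ℝ) (hα : Irrational α) (hα01 : α ∈ Set.Ioo (0 : ℝ) 1) :
    ((Summable fun n : ℕ => W α (n + 1)) →
      ∀ᵐ x : UnitAddCircle, extravagance α x = 0) ∧
    ((¬ Summable fun n : ℕ => W α (n + 1)) →
      ∀ᵐ x : UnitAddCircle, extravagance α x = ⊤) := by
  obtain ⟨q, hq, H⟩ := exists_isDenomSeq hα
  exact ⟨H.ae_extravagance_eq_zero hq, H.ae_extravagance_eq_top hα hq⟩
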